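/- Let $n\ge 1$ be an integer, let $h(t)=(t,\cos t,\sin t)\in\mathbb{R}^3$, $h_n(t)=h(2\pi t/n)$ and $\mathcal H_n=\{h_n(t)\mid t\in\mathbb Z\}$. A Delaunay cell of $\mathcal H_n$ is a nonempty set consisting of all points of $\mathcal H_n$ on some sphere that has no point of $\mathcal H_n$ in its interior; it is a Delaunay simplex if its points are affinely independent. Let $V_n(t)$ be the closed Voronoi region of $h_n(t)$ with respect to $\mathcal H_n$, and let $F_k=V_n(t)\cap V_n(t+k)$. (a) Every Delaunay cell of $\mathcal H_n$ is a simplex (so that the Delaunay subdivision of $\mathcal H_n$ is a triangulation), and for all integers $a<b<c<d$, the points $h_n(a),h_n(b),h_n(c),h_n(d)$ are the vertices of a simplex in the Delaunay triangulation of $\mathcal H_n$ if and only if $b-a=d-c=1$ and $d-a\le n$. (b) For every integer $t$, the region $V_n(t)$ is a three-dimensional convex polyhedron with exactly $2n$ facets, namely the sets $F_k$ with $1\le|k|\le n$. They form $n$ symmetric pairs: some involutive isometry of $\mathbb{R}^3$ maps $V_n(t)$ to itself and every $F_k$ to $F_{-k}$. (c) If $n\ge 4$, then for every integer $t$: $F_{\pm1}$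 are unbounded $(2n-2)$-gons, each bounded by $2n-4$ segments and two parallel rays; $F_{\pm2}$ are triangles; $F_k$ with $3\le|k|\le n-2$ are quadrilaterals; $F_{\pm(n-1)}$ are unbounded quadrilaterals, each bounded by two segments and two parallel rays; and $F_{\pm n}$ are wedges in parallel planes, each bounded by a pair of rays. The union $F_1\cup F_{-1}$ contains all vertices of $V_n(t)$. The facet $F_1$ is adjacent to (shares an edge with) every other facet except $F_{-n}$, and $F_{-1}$ is adjacent to every other facet except $F_n$; two distinct facets $F_i,F_j$ with $|i|,|j|\ge2$ are adjacent if and only if $|i-j|=1$. -/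

import Mathlib

noncomputable section

/-- Euclidean three-space. -/
abbrev E3 : Type := EuclideanSpace ℝ (Fin 3)

/-- The regular circular helix `h(t) = (t, cos t, sin t)`. -/
def helix (t : ℝ) : E3 := !₂[t, Real.cos t, Real.sin t]

/-- The evenly spaced points `h_n(t) = h(2πt/n)`, `t ∈ ℤ`. -/
def helixPt (n : ℕ) (t : ℤ) : E3 := helix (2 * Real.pi * (t : ℝ) / (n : ℝ))

/-- The infinite point set `H_n = {h_n(t) | t ∈ ℤ}`. -/
def helixSet (n : ℕ) : Set E3 := Set.range (helixPt n)

/-- `T` is (the set of sites of) a cell of the Delaunay subdivision of `S`: there is a sphere with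
no point of `S` in its interior, and `T` is the nonempty set of all points of `S` on it. -/
def IsDelaunayCell (S T : Set E3) : Prop :=
  T.Nonempty ∧ ∃ (c : E3) (r : ℝ), (∀ p ∈ S, r ≤ dist p c) ∧ T = {p ∈ S | dist p c = r}

/-- `T` is the vertex set of a simplex of the Delaunay subdivision of `S`. -/
def IsDelaunaySimplex (S T : Set E3) : Prop :=
  IsDelaunayCell S T ∧ AffineIndependent ℝ (fun p : T => (p : E3))

/-- The Delaunay subdivision of `S` is a triangulation: every one of its cells is a simplex. -/
def DelaunayIsTriangulation (S : Set E3) : Prop :=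
  ∀ T : Set E3, IsDelaunayCell S T → IsDelaunaySimplex S T

/-- The (closed) Voronoi region of the site `p` of `S`. -/
def voronoiRegion (S : Set E3) (p : E3) : Set E3 := {x | ∀ q ∈ S, dist x p ≤ dist x q}

/-- The Voronoi region `V_n(t)` of `h_n(t)` with respect to `H_n`. -/
def helixRegion (n : ℕ) (t : ℤ) : Set E3 := voronoiRegion (helixSet n) (helixPt n t)

/-- The intersection `V_n(t) ∩ V_n(t + k)`. -/
def helixFacet (n : ℕ) (t k : ℤ) : Set E3 := helixRegion n t ∩ helixRegion n (t + k)

/-- A (convex, possibly unbounded) polyhedron: an intersection of finitely many closed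
half-spaces. -/
def IsPolyhedron (A : Set E3) : Prop :=
  ∃ s : Finset (E3 × ℝ), (∀ p ∈ s, p.1 ≠ 0) ∧ A = {x | ∀ p ∈ s, inner ℝ p.1 x ≤ p.2}

/-- The dimension of (the affine hull of) a nonempty set. -/
def affDim (A : Set E3) : ℕ := Module.finrank ℝ (vectorSpan ℝ A)

/-- `B` is a `k`-dimensional face of the polyhedron `A`. -/
def IsFace (A B : Set E3) (k : ℕ) : Prop :=
  B.Nonempty ∧ IsExposed ℝ A B ∧ affDim B = k

/-- The facets of a three-dimensional polyhedron. -/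
def facets (A : Set E3) : Set (Set E3) := {F | IsFace A F 2}

/-- The edges (one-dimensional faces) of a polyhedron or polygon. -/
def edges (A : Set E3) : Set (Set E3) := {e | IsFace A e 1}

/-- `e` is a nondegenerate line segment. -/
def IsSegment (e : Set E3) : Prop := ∃ p q : E3, p ≠ q ∧ e = segment ℝ p q

/-- The closed ray from `p` in direction `v`. -/
def rayFrom (p v : E3) : Set E3 := {x | ∃ s : ℝ, 0 ≤ s ∧ x = p + s • v}

/-- `e` is a ray. -/
def IsRay (e : Set E3) : Prop := ∃ p v : E3, v ≠ 0 ∧ e = rayFrom p v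

/-- The polygon `F` is bounded by exactly `s` segments and `r` rays. -/
def BoundedBy (F : Set E3) (s r : ℕ) : Prop :=
  (∀ e ∈ edges F, IsSegment e ∨ IsRay e) ∧
    {e ∈ edges F | IsSegment e}.encard = s ∧ {e ∈ edges F | IsRay e}.encard = r

/-- The rays bounding the polygon `F` are all parallel. -/
def ParallelRays (F : Set E3) : Prop :=
  ∃ v : E3, v ≠ 0 ∧ ∀ e ∈ edges F, IsRay e → ∃ p : E3, e = rayFrom p v

/-- Two facets are adjacent if they share an edge. -/
def AdjacentFacets (F G : Set E3) : Prop := affDim (F ∩ G) = 1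

end

/-!
The power of a point `x` with respect to a site `p`, `‖p‖² - 2⟪p, x⟫`, differs from the squared
distance by a term independent of `p` and is affine in `x`. Hence, for a locally finite set of
sites, moving from `x` along a vector orthogonal to all differences of its nearest sites keeps
these sites nearest for a while, and the faces of a Voronoi region are the loci at which a given
set of sites, the set of all nearest sites of some point, is nearest.

Along the helix the power of `x` is a quadratic polynomial plus a trigonometric polynomial of degree
one in the parameter. If it were alternately at most and at least some level at five parameters
within one turn, then by Rolle's theorem its second derivative, a trigonometric polynomial of degree
one, would alternate in sign at four, which is impossible. So a point has at most four nearest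
sites, and four of them form two pairs of consecutive sites within one turn; such sites are affinely
independent. Conversely, any two such pairs are the contact of an empty sphere centred on the
principal normal at the middle parameter, about which the helix has a half-turn symmetry. This
determines all sets of nearest sites: the edges of the Voronoi regions are dual to triples of sites
within one turn, two of them consecutive, with a ray exactly when two are one full turn apart, and
the shapes and adjacencies of the facets are read off by counting triples.
-/

open Real Set Filter Topology

/-! ### Nearest sites and Voronoi faces -/

section NearestSites

variable {ι X : Type*} [PseudoMetricSpace X] {P : ι → X} {x y : X} {I J : Set ι}

/-- The indices of the sites nearest to `x`. -/
def nearestSites (P : ι → X) (x : X) : Set ι := {i | ∀ j, dist x (P i) ≤ dist x (P j)}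

/-- The locus of the points having all sites with indices in `J` among their nearest ones: the
Voronoi region of a site when `J` is a singleton, and in general an intersection of regions. -/
def voronoiFace (P : ι → X) (J : Set ι) : Set X := {x | J ⊆ nearestSites P x}

theorem nearestSites_self {X : Type*} [MetricSpace X] {P : ι → X} (hP : Function.Injective P)
    (i : ι) : nearestSites P (P i) = {i} := by
  ext j
  refine ⟨fun hj => ?_, ?_⟩
  · have h := hj i
    rw [dist_self, dist_le_zero] at h
    exact (hP h).symm
  · rintro rfl k
    rw [dist_self]
    exact dist_nonneg

theorem voronoiFace_union (I J : Set ι) :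
    voronoiFace P (I ∪ J) = voronoiFace P I ∩ voronoiFace P J :=
  Set.ext fun _ => union_subset_iff

theorem voronoiFace_anti (h : I ⊆ J) : voronoiFace P J ⊆ voronoiFace P I :=
  fun _ hx => h.trans hx

theorem mem_voronoiFace_nearestSites (P : ι → X) (x : X) :
    x ∈ voronoiFace P (nearestSites P x) :=
  Subset.refl (nearestSites P x)

theorem nearestSites_eq_of_voronoiFace_eq
    (h : voronoiFace P (nearestSites P x) = voronoiFace P (nearestSites P y)) :
    nearestSites P x = nearestSites P y :=
  Subset.antisymm (h.symm.subset (mem_voronoiFace_nearestSites P y))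
    (h.subset (mem_voronoiFace_nearestSites P x))

theorem image_voronoiFace_of_perm (σ : X ≃ᵢ X) (e : Equiv.Perm ι) (h : ∀ i, σ (P i) = P (e i))
    (J : Set ι) : σ '' voronoiFace P J = voronoiFace P (e '' J) := by
  have hmem : ∀ i x, e i ∈ nearestSites P (σ x) ↔ i ∈ nearestSites P x := fun i x => by
    rw [nearestSites, nearestSites, mem_ofPred_eq, mem_ofPred_eq, e.surjective.forall]
    simp only [← h, σ.dist_eq]
  ext y
  obtain ⟨x, rfl⟩ := σ.surjective y
  rw [σ.injective.mem_set_image, voronoiFace, voronoiFace, mem_ofPred_eq, mem_ofPred_eq,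
    subset_def, subset_def, forall_mem_image]
  simp only [hmem]

theorem finite_setOf_dist_le (hP : Tendsto P cofinite (Bornology.cobounded X)) (x : X) (r : ℝ) :
    {i | dist x (P i) ≤ r}.Finite := by
  have h := ((Metric.tendsto_dist_left_cobounded_atTop x).comp hP).eventually_gt_atTop r
  simpa only [eventually_cofinite, Function.comp_apply, not_lt] using h

theorem nearestSites_finite (hP : Tendsto P cofinite (Bornology.cobounded X)) (x : X) :
    (nearestSites P x).Finite := by
  rcases (nearestSites P x).eq_empty_or_nonempty with h | ⟨p, -⟩
  · exact h ▸ finite_empty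
  · exact (finite_setOf_dist_le hP x (dist x (P p))).subset fun i hi => hi p

theorem nearestSites_nonempty [Nonempty ι] (hP : Tendsto P cofinite (Bornology.cobounded X))
    (x : X) : (nearestSites P x).Nonempty :=
  ((Metric.tendsto_dist_left_cobounded_atTop x).comp hP).exists_forall_le

theorem eventually_nearestSites_subset (hP : Tendsto P cofinite (Bornology.cobounded X)) (x : X) :
    ∀ᶠ y in 𝓝 x, nearestSites P y ⊆ nearestSites P x := by
  cases isEmpty_or_nonempty ι
  · exact Eventually.of_forall fun y i => isEmptyElim i
  obtain ⟨p, hp⟩ := nearestSites_nonempty hP x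
  have hnear : ∀ i ∈ {i | dist x (P i) ≤ dist x (P p) + 2},
      ∀ᶠ y in 𝓝 x, i ∉ nearestSites P x → dist y (P p) < dist y (P i) := by
    intro i _
    by_cases hi : i ∈ nearestSites P x
    · exact Eventually.of_forall fun y h => absurd hi h
    · have hlt : dist x (P p) < dist x (P i) := lt_of_not_ge fun h => hi fun j => h.trans (hp j)
      have hcont : ∀ q : X, ContinuousAt (fun y => dist y q) x := fun q => by fun_prop
      filter_upwards [(hcont (P p)).eventually_lt (hcont (P i)) hlt] with y hy _ using hy
  filter_upwards [(eventually_all_finite (finite_setOf_dist_le hP x _)).2 hnear,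
    Metric.ball_mem_nhds x one_pos] with y hy hyx i hi
  by_contra hix
  have hyp := hi p
  have h1 := dist_triangle_left x (P i) y
  have h2 := dist_triangle y x (P p)
  rw [Metric.mem_ball] at hyx
  exact (hy i (show dist x (P i) ≤ _ by linarith) hix).not_ge hyp

end NearestSites

section Voronoi

open scoped RealInnerProductSpace

variable {ι E : Type*} [NormedAddCommGroup E] [InnerProductSpace ℝ E] {P : ι → E} {x y v : E}
  {i j : ι} {I J : Set ι}

/-- The power of `x` with respect to the site `p`: the squared distance from `x` to `p`, less the
term `‖x‖ ^ 2` common to all sites, so that it is affine in `x`. -/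
def sitePower (p x : E) : ℝ := ‖p‖ ^ 2 - 2 * ⟪p, x⟫

theorem dist_sq_eq_norm_sq_add_sitePower (p x : E) : dist x p ^ 2 = ‖x‖ ^ 2 + sitePower p x := by
  rw [dist_eq_norm, norm_sub_sq_real, sitePower, real_inner_comm]
  ring

theorem dist_le_dist_iff_sitePower_le (p q x : E) :
    dist x p ≤ dist x q ↔ sitePower p x ≤ sitePower q x := by
  rw [← sq_le_sq₀ dist_nonneg dist_nonneg, dist_sq_eq_norm_sq_add_sitePower,
    dist_sq_eq_norm_sq_add_sitePower, add_le_add_iff_left]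

theorem sitePower_add_smul (p x v : E) (c : ℝ) :
    sitePower p (x + c • v) = sitePower p x - 2 * c * ⟪p, v⟫ := by
  rw [sitePower, sitePower, inner_add_right, inner_smul_right]
  ring

theorem sitePower_combo (p x y : E) {a b : ℝ} (hab : a + b = 1) :
    sitePower p (a • x + b • y) = a * sitePower p x + b * sitePower p y := by
  obtain rfl : a = 1 - b := by linarith
  simp only [sitePower, inner_add_right, inner_smul_right]
  ring

theorem mem_nearestSites_iff :
    i ∈ nearestSites P x ↔ ∀ j, sitePower (P i) x ≤ sitePower (P j) x :=
  forall_congr' fun j => dist_le_dist_iff_sitePower_le (P i) (P j) x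

theorem sitePower_eq_of_mem (hi : i ∈ nearestSites P x) (hj : j ∈ nearestSites P x) :
    sitePower (P i) x = sitePower (P j) x :=
  le_antisymm (mem_nearestSites_iff.1 hi j) (mem_nearestSites_iff.1 hj i)

theorem mem_nearestSites_of_le (hi : i ∈ nearestSites P x)
    (h : sitePower (P j) x ≤ sitePower (P i) x) : j ∈ nearestSites P x :=
  mem_nearestSites_iff.2 fun k => h.trans (mem_nearestSites_iff.1 hi k)

theorem sitePower_lt_of_notMem (hi : i ∈ nearestSites P x) (hj : j ∉ nearestSites P x) :
    sitePower (P i) x < sitePower (P j) x :=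
  lt_of_not_ge fun h => hj (mem_nearestSites_of_le hi h)

theorem nearestSites_combo {a b : ℝ} (ha : 0 < a) (hb : 0 < b) (hab : a + b = 1)
    (h : (nearestSites P x ∩ nearestSites P y).Nonempty) :
    nearestSites P (a • x + b • y) = nearestSites P x ∩ nearestSites P y := by
  obtain ⟨p, hpx, hpy⟩ := h
  have hp : p ∈ nearestSites P (a • x + b • y) := mem_nearestSites_iff.2 fun k => by
    rw [sitePower_combo _ _ _ hab, sitePower_combo _ _ _ hab]
    gcongr
    exacts [mem_nearestSites_iff.1 hpx k, mem_nearestSites_iff.1 hpy k]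
  ext s
  refine ⟨fun hs => ?_, fun hs => mem_nearestSites_of_le hp ?_⟩
  · have heq := sitePower_eq_of_mem hs hp
    rw [sitePower_combo _ _ _ hab, sitePower_combo _ _ _ hab] at heq
    have hx := mem_nearestSites_iff.1 hpx s
    have hy := mem_nearestSites_iff.1 hpy s
    exact ⟨mem_nearestSites_of_le hpx (by nlinarith), mem_nearestSites_of_le hpy (by nlinarith)⟩
  · rw [sitePower_combo _ _ _ hab, sitePower_combo _ _ _ hab, sitePower_eq_of_mem hs.1 hpx,
      sitePower_eq_of_mem hs.2 hpy]

theorem nearestSites_eq_of_sitePower {c : ℝ} (hI : I.Nonempty)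
    (hon : ∀ i ∈ I, sitePower (P i) x = c) (hoff : ∀ i ∉ I, c < sitePower (P i) x) :
    nearestSites P x = I := by
  obtain ⟨i, hi⟩ := hI
  ext j
  refine ⟨fun hj => ?_, fun hj => mem_nearestSites_iff.2 fun k => ?_⟩
  · by_contra hjI
    exact (hoff j hjI).not_ge ((mem_nearestSites_iff.1 hj i).trans_eq (hon i hi))
  · rw [hon j hj]
    by_cases hk : k ∈ I
    exacts [(hon k hk).ge, (hoff k hk).le]

theorem nearestSites_midpoint (h : (nearestSites P x ∩ nearestSites P y).Nonempty) :
    nearestSites P (midpoint ℝ x y) = nearestSites P x ∩ nearestSites P y := by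
  rw [midpoint_eq_smul_add, smul_add]
  exact nearestSites_combo (by norm_num) (by norm_num) (by norm_num) h

theorem nearestSites_add_smul {m c : ℝ} (hc : 0 < c) (hm : ∀ s, ⟪P s, v⟫ ≤ m)
    (h : {s ∈ nearestSites P x | ⟪P s, v⟫ = m}.Nonempty) :
    nearestSites P (x + c • v) = {s ∈ nearestSites P x | ⟪P s, v⟫ = m} := by
  obtain ⟨p, hp, hpm⟩ := h
  have hpc : p ∈ nearestSites P (x + c • v) := mem_nearestSites_iff.2 fun k => by
    rw [sitePower_add_smul, sitePower_add_smul, hpm]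
    gcongr
    exacts [mem_nearestSites_iff.1 hp k, hm k]
  ext s
  refine ⟨fun hs => ?_, fun hs => mem_nearestSites_of_le hpc ?_⟩
  · have heq := sitePower_eq_of_mem hs hpc
    rw [sitePower_add_smul, sitePower_add_smul, hpm] at heq
    have hps := mem_nearestSites_iff.1 hp s
    have hsm := hm s
    exact ⟨mem_nearestSites_of_le hp (by nlinarith), le_antisymm hsm (by nlinarith)⟩
  · rw [sitePower_add_smul, sitePower_add_smul, hpm, hs.2, sitePower_eq_of_mem hs.1 hp]

/-- The vectors orthogonal to all differences of the sites with indices in `I`. -/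
noncomputable def siteOrthogonal (P : ι → E) (I : Set ι) : Submodule ℝ E := (vectorSpan ℝ (P '' I))ᗮ

theorem mem_siteOrthogonal_iff :
    v ∈ siteOrthogonal P I ↔ ∀ i ∈ I, ∀ j ∈ I, ⟪P i, v⟫ = ⟪P j, v⟫ := by
  rw [siteOrthogonal, vectorSpan_def, Submodule.mem_orthogonal]
  constructor
  · intro h i hi j hj
    have := h _ (Submodule.subset_span (vsub_mem_vsub (mem_image_of_mem P hi)
      (mem_image_of_mem P hj)))
    rwa [vsub_eq_sub, inner_sub_left, sub_eq_zero] at this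
  · intro h u hu
    induction hu using Submodule.span_induction with
    | mem u hu =>
      obtain ⟨_, ⟨i, hi, rfl⟩, _, ⟨j, hj, rfl⟩, rfl⟩ := hu
      change ⟪P i - P j, v⟫ = 0
      rw [inner_sub_left, h i hi j hj, sub_self]
    | zero => exact inner_zero_left v
    | add u w _ _ hu hw => rw [inner_add_left, hu, hw, add_zero]
    | smul c u _ hu => rw [real_inner_smul_left, hu, mul_zero]

theorem convex_voronoiFace (P : ι → E) (J : Set ι) : Convex ℝ (voronoiFace P J) := by
  intro x hx y hy a b ha hb hab j hj
  rw [mem_nearestSites_iff]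
  intro k
  rw [sitePower_combo _ _ _ hab, sitePower_combo _ _ _ hab]
  gcongr
  exacts [mem_nearestSites_iff.1 (hx hj) k, mem_nearestSites_iff.1 (hy hj) k]

theorem sub_mem_siteOrthogonal (hx : x ∈ voronoiFace P J) (hy : y ∈ voronoiFace P J) :
    x - y ∈ siteOrthogonal P J := by
  rw [mem_siteOrthogonal_iff]
  intro i hi j hj
  have h1 := sitePower_eq_of_mem (hx hi) (hx hj)
  have h2 := sitePower_eq_of_mem (hy hi) (hy hj)
  rw [sitePower, sitePower] at h1 h2
  rw [inner_sub_right, inner_sub_right]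
  linarith

theorem eventually_nearestSites_add_smul_eq (hP : Tendsto P cofinite (Bornology.cobounded E))
    (hv : v ∈ siteOrthogonal P (nearestSites P x)) :
    ∀ᶠ c : ℝ in 𝓝 0, nearestSites P (x + c • v) = nearestSites P x := by
  cases isEmpty_or_nonempty ι
  · exact Eventually.of_forall fun c => Subsingleton.elim _ _
  have htends : Tendsto (fun c : ℝ => x + c • v) (𝓝 0) (𝓝 x) :=
    Continuous.tendsto' (by fun_prop) 0 x (by simp)
  filter_upwards [htends.eventually (eventually_nearestSites_subset hP x)] with c hc
  obtain ⟨q, hq⟩ := nearestSites_nonempty hP (x + c • v)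
  refine hc.antisymm fun s hs => mem_nearestSites_of_le hq ?_
  rw [sitePower_add_smul, sitePower_add_smul, sitePower_eq_of_mem hs (hc hq),
    mem_siteOrthogonal_iff.1 hv s hs q (hc hq)]

theorem exists_pos_nearestSites_add_smul_eq (hP : Tendsto P cofinite (Bornology.cobounded E))
    (hv : v ∈ siteOrthogonal P (nearestSites P x)) :
    ∃ c : ℝ, 0 < c ∧ nearestSites P (x + c • v) = nearestSites P x ∧
      nearestSites P (x + (-c) • v) = nearestSites P x := by
  have h := eventually_nearestSites_add_smul_eq hP hv
  exact (h.and ((continuous_neg.tendsto' (0 : ℝ) 0 neg_zero).eventually h)).exists_gt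

theorem vectorSpan_voronoiFace (hP : Tendsto P cofinite (Bornology.cobounded E)) (x : E) :
    vectorSpan ℝ (voronoiFace P (nearestSites P x)) = siteOrthogonal P (nearestSites P x) := by
  apply le_antisymm
  · rw [vectorSpan_def, Submodule.span_le]
    rintro _ ⟨y, hy, z, hz, rfl⟩
    exact sub_mem_siteOrthogonal hy hz
  · intro v hv
    obtain ⟨c, hc, h, -⟩ := exists_pos_nearestSites_add_smul_eq hP hv
    have hmem := vsub_mem_vectorSpan ℝ (s := voronoiFace P (nearestSites P x)) h.ge
      (mem_voronoiFace_nearestSites P x)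
    rw [vsub_eq_sub, add_sub_cancel_left] at hmem
    exact ((vectorSpan ℝ _).smul_mem_iff hc.ne').1 hmem

theorem finrank_siteOrthogonal_add_ncard [FiniteDimensional ℝ E] (hI : I.Finite)
    (hne : I.Nonempty) (hind : AffineIndependent ℝ fun i : I => P i) :
    Module.finrank ℝ (siteOrthogonal P I) + I.ncard = Module.finrank ℝ E + 1 := by
  have := hI.fintype
  have hcard : Fintype.card I = I.ncard := by rw [← Nat.card_eq_fintype_card, Nat.card_coe_set_eq]
  have hpos := (Set.ncard_pos hI).2 hne
  have hspan := hind.finrank_vectorSpan (n := I.ncard - 1) (by omega)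
  rw [← Set.image_eq_range] at hspan
  have hsum := (vectorSpan ℝ (P '' I)).finrank_add_finrank_orthogonal
  rw [siteOrthogonal]
  omega

/-! ### Exposed faces of Voronoi regions -/

theorem isExposed_voronoiFace_union_singleton (hJ : J.Nonempty) (i : ι) :
    IsExposed ℝ (voronoiFace P J) (voronoiFace P (J ∪ {i})) := by
  rintro ⟨x, hx⟩
  rw [voronoiFace_union] at hx ⊢
  obtain ⟨p, hp⟩ := hJ
  have hval : ∀ y, innerSL ℝ (P i - P p) y =
      (‖P i‖ ^ 2 - ‖P p‖ ^ 2 + (sitePower (P p) y - sitePower (P i) y)) / 2 := fun y => by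
    rw [innerSL_apply_apply, inner_sub_left, sitePower, sitePower]
    ring
  refine ⟨innerSL ℝ (P i - P p), Set.ext fun y => ⟨fun ⟨hy, hyi⟩ => ⟨hy, fun z hz => ?_⟩,
    fun ⟨hy, hmax⟩ => ⟨hy, ?_⟩⟩⟩
  · have hz := mem_nearestSites_iff.1 (hz hp) i
    have hy := sitePower_eq_of_mem (hyi rfl) (hy hp)
    rw [hval, hval]
    linarith
  · have hx' := sitePower_eq_of_mem (hx.2 rfl) (hx.1 hp)
    have hyx := hmax x hx.1
    rw [hval, hval] at hyx
    rintro _ rfl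
    exact mem_nearestSites_of_le (hy hp) (by linarith)

theorem isExposed_voronoiFace (hJ : J.Nonempty) (hI : I.Finite) (hJI : J ⊆ I) :
    IsExposed ℝ (voronoiFace P J) (voronoiFace P I) := by
  suffices h : IsExposed ℝ (voronoiFace P J) (voronoiFace P (J ∪ I)) by
    rwa [union_eq_self_of_subset_left hJI] at h
  clear hJI
  induction I, hI using Set.Finite.induction_on with
  | empty => rw [union_empty]
  | @insert i I _ _ ih =>
    have h := ih.inter (isExposed_voronoiFace_union_singleton (P := P) hJ i)
    rwa [← voronoiFace_union, union_union_union_comm, union_self, union_singleton] at h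

theorem exists_eq_voronoiFace_of_isExposed (hP : Tendsto P cofinite (Bornology.cobounded E))
    (hJ : J.Nonempty) {B : Set E} (hB : B.Nonempty) (h : IsExposed ℝ (voronoiFace P J) B) :
    ∃ x, J ⊆ nearestSites P x ∧ B = voronoiFace P (nearestSites P x) := by
  -- A point of `B` with as few nearest sites as possible lies in the relative interior of `B`.
  obtain ⟨x, hx, hmin⟩ : ∃ x ∈ B, ∀ y ∈ B, (nearestSites P x).ncard ≤ (nearestSites P y).ncard :=
    let card := fun y => (nearestSites P y).ncard
    ⟨_, Function.argminOn_mem card B hB, fun _ => Function.argminOn_le card B⟩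
  have hxJ : J ⊆ nearestSites P x := h.subset hx
  refine ⟨x, hxJ, Subset.antisymm (fun y hy => ?_) fun y hy => ?_⟩
  · have hmid := nearestSites_midpoint (hJ.mono (subset_inter hxJ (h.subset hy)))
    have hle := hmin _ ((h.convex (convex_voronoiFace P J)).midpoint_mem hx hy)
    rw [hmid] at hle
    exact inter_eq_left.1 (Set.eq_of_subset_of_ncard_le inter_subset_left hle
      (nearestSites_finite hP x))
  · obtain ⟨c, hc, hpos, hneg⟩ := exists_pos_nearestSites_add_smul_eq hP
      (sub_mem_siteOrthogonal hy (mem_voronoiFace_nearestSites P x))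
    obtain ⟨l, rfl⟩ := h hB
    have h1 := hx.2 _ (hxJ.trans hpos.ge)
    have h2 := hx.2 _ (hxJ.trans hneg.ge)
    simp only [map_add, map_smul, map_sub, smul_eq_mul] at h1 h2
    have hyx : l y = l x := by nlinarith
    exact ⟨voronoiFace_anti hxJ hy, fun z hz => (hx.2 z hz).trans hyx.ge⟩

/-! ### Edges of the Voronoi diagram -/

theorem exists_eq_add_smul_of_mem_voronoiFace (hrank : Module.finrank ℝ (siteOrthogonal P I) = 1)
    (hv : v ∈ siteOrthogonal P I) (hv0 : v ≠ 0) (hx : x ∈ voronoiFace P I)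
    (hy : y ∈ voronoiFace P I) : ∃ c : ℝ, y = x + c • v := by
  have hv0' : (⟨v, hv⟩ : siteOrthogonal P I) ≠ 0 := by simpa using hv0
  obtain ⟨c, hc⟩ := (finrank_eq_one_iff_of_nonzero' _ hv0').1 hrank
    ⟨y - x, sub_mem_siteOrthogonal hy hx⟩
  exact ⟨c, eq_add_of_sub_eq' (congrArg Subtype.val hc).symm⟩

theorem voronoiFace_inter_eq_segment
    (hrank : Module.finrank ℝ (siteOrthogonal P (nearestSites P x ∩ nearestSites P y)) = 1)
    (hne : (nearestSites P x ∩ nearestSites P y).Nonempty) (hi : i ∈ nearestSites P x)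
    (hi' : i ∉ nearestSites P y) (hj : j ∈ nearestSites P y) (hj' : j ∉ nearestSites P x) :
    voronoiFace P (nearestSites P x ∩ nearestSites P y) = segment ℝ x y := by
  have hx : x ∈ voronoiFace P (nearestSites P x ∩ nearestSites P y) := inter_subset_left
  have hy : y ∈ voronoiFace P (nearestSites P x ∩ nearestSites P y) := inter_subset_right
  refine Subset.antisymm (fun z hz => ?_) ((convex_voronoiFace P _).segment_subset hx hy)
  obtain ⟨c, rfl⟩ := exists_eq_add_smul_of_mem_voronoiFace hrank (sub_mem_siteOrthogonal hy hx)
    (sub_ne_zero.2 fun h => hi' (h ▸ hi)) hx hz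
  obtain ⟨p, hp⟩ := hne
  have hcombo : x + c • (y - x) = (1 - c) • x + c • y := by module
  have hpi := mem_nearestSites_iff.1 (hz hp) i
  have hpj := mem_nearestSites_iff.1 (hz hp) j
  have hiy := sitePower_lt_of_notMem hp.2 hi'
  have hjx := sitePower_lt_of_notMem hp.1 hj'
  rw [hcombo, sitePower_combo _ _ _ (sub_add_cancel 1 c),
    sitePower_combo _ _ _ (sub_add_cancel 1 c)] at hpi hpj
  rw [sitePower_eq_of_mem hi hp.1] at hpi
  rw [sitePower_eq_of_mem hj hp.2] at hpj
  exact hcombo ▸ ⟨1 - c, c, by nlinarith, by nlinarith, by ring, rfl⟩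

theorem voronoiFace_eq_ray {m : ℝ} (hm : ∀ s, ⟪P s, v⟫ ≤ m)
    (hrank : Module.finrank ℝ (siteOrthogonal P {s ∈ nearestSites P x | ⟪P s, v⟫ = m}) = 1)
    (hne : {s ∈ nearestSites P x | ⟪P s, v⟫ = m}.Nonempty) (hi : i ∈ nearestSites P x)
    (hi' : ⟪P i, v⟫ ≠ m) :
    voronoiFace P {s ∈ nearestSites P x | ⟪P s, v⟫ = m} =
      {y | ∃ c : ℝ, 0 ≤ c ∧ y = x + c • v} := by
  have hx : x ∈ voronoiFace P {s ∈ nearestSites P x | ⟪P s, v⟫ = m} := sep_subset _ _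
  have hv : v ∈ siteOrthogonal P {s ∈ nearestSites P x | ⟪P s, v⟫ = m} :=
    mem_siteOrthogonal_iff.2 fun a ha b hb => ha.2.trans hb.2.symm
  refine Subset.antisymm (fun y hy => ?_) ?_
  · obtain ⟨p, hp⟩ := hne
    have hv0 : v ≠ 0 := by
      rintro rfl
      exact hi' (by rw [← hp.2, inner_zero_right, inner_zero_right])
    obtain ⟨c, rfl⟩ := exists_eq_add_smul_of_mem_voronoiFace hrank hv hv0 hx hy
    have hpi := mem_nearestSites_iff.1 (hy hp) i
    rw [sitePower_add_smul, sitePower_add_smul, sitePower_eq_of_mem hi hp.1, hp.2] at hpi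
    have him := lt_of_le_of_ne (hm i) hi'
    exact ⟨c, by nlinarith, rfl⟩
  · rintro _ ⟨c, hc, rfl⟩
    rcases hc.eq_or_lt with rfl | hc
    · rwa [zero_smul, add_zero]
    · exact (nearestSites_add_smul hc hm hne).ge

end Voronoi

/-! ### Polyhedra, Delaunay cells and Voronoi faces in three-space -/

section Space

variable {ι : Type*} {P : ι → E3} {x y : E3} {i j : ι} {I J : Set ι}

theorem not_isRay_of_isSegment {e : Set E3} (h : IsSegment e) : ¬ IsRay e := by
  rintro ⟨p, v, hv, rfl⟩
  obtain ⟨a, b, -, he⟩ := h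
  have hbdd : Bornology.IsBounded (rayFrom p v) := by
    rw [he, ← convexHull_pair]
    exact isBounded_convexHull.2 (toFinite _).isBounded
  have hsmul : Tendsto (fun s : ℝ => s • v) atTop (Bornology.cobounded E3) := by
    rw [← tendsto_norm_atTop_iff_cobounded]
    simp only [norm_smul, Real.norm_eq_abs]
    exact tendsto_abs_atTop_atTop.atTop_mul_const (norm_pos_iff.2 hv)
  have hlim : Tendsto (fun s : ℝ => p + s • v) atTop (Bornology.cobounded E3) :=
    (tendsto_const_add_cobounded p).comp hsmul
  obtain ⟨s, hs, hs0⟩ := ((hlim.eventually hbdd).and (eventually_ge_atTop 0)).exists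
  exact hs ⟨s, hs0, rfl⟩

theorem boundedBy_of_edges_eq_image {F : Set E3} {f : ι → Set E3} {S R : Finset ι}
    (hF : edges F = f '' (S ∪ R)) (hinj : InjOn f (S ∪ R)) (hS : ∀ i ∈ S, IsSegment (f i))
    (hR : ∀ i ∈ R, IsRay (f i)) : BoundedBy F S.card R.card := by
  have hseg : {e ∈ edges F | IsSegment e} = f '' S := by
    rw [hF]
    ext e
    constructor
    · rintro ⟨⟨i, hi | hi, rfl⟩, he⟩
      exacts [⟨i, hi, rfl⟩, absurd (hR i hi) (not_isRay_of_isSegment he)]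
    · rintro ⟨i, hi, rfl⟩
      exact ⟨⟨i, Or.inl hi, rfl⟩, hS i hi⟩
  have hray : {e ∈ edges F | IsRay e} = f '' R := by
    rw [hF]
    ext e
    constructor
    · rintro ⟨⟨i, hi | hi, rfl⟩, he⟩
      exacts [absurd he (not_isRay_of_isSegment (hS i hi)), ⟨i, hi, rfl⟩]
    · rintro ⟨i, hi, rfl⟩
      exact ⟨⟨i, Or.inr hi, rfl⟩, hR i hi⟩
  refine ⟨?_, ?_, ?_⟩
  · rw [hF]
    rintro _ ⟨i, hi | hi, rfl⟩
    exacts [Or.inl (hS i hi), Or.inr (hR i hi)]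
  · rw [hseg, (hinj.mono subset_union_left).encard_image, encard_coe_eq_coe_finsetCard]
  · rw [hray, (hinj.mono subset_union_right).encard_image, encard_coe_eq_coe_finsetCard]

theorem isPolyhedron_setOf_sitePower_le (s : Finset ι) (p : E3) (h : ∀ i ∈ s, P i ≠ p) :
    IsPolyhedron {x | ∀ i ∈ s, sitePower p x ≤ sitePower (P i) x} := by
  classical
  refine ⟨s.image fun i => (P i - p, (‖P i‖ ^ 2 - ‖p‖ ^ 2) / 2), ?_, ?_⟩
  · simpa only [Finset.forall_mem_image, sub_ne_zero] using h
  · ext x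
    rw [mem_ofPred_eq, mem_ofPred_eq, Finset.forall_mem_image]
    refine forall₂_congr fun i _ => ?_
    rw [inner_sub_left, sitePower, sitePower]
    constructor <;> intro h <;> linarith

theorem voronoiRegion_range (P : ι → E3) (i : ι) :
    voronoiRegion (range P) (P i) = voronoiFace P {i} := by
  ext x
  rw [voronoiRegion, voronoiFace, mem_ofPred_eq, mem_ofPred_eq, forall_mem_range,
    singleton_subset_iff]
  rfl

theorem isDelaunayCell_range_iff {T : Set E3} : IsDelaunayCell (range P) T ↔
    ∃ x, (nearestSites P x).Nonempty ∧ T = P '' nearestSites P x := by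
  have hsphere : ∀ x r i, i ∈ nearestSites P x → dist x (P i) = r →
      {p ∈ range P | dist p x = r} = P '' nearestSites P x := by
    rintro x _ i hi rfl
    ext p
    constructor
    · rintro ⟨⟨j, rfl⟩, hj⟩
      rw [dist_comm] at hj
      exact ⟨j, fun k => hj.trans_le (hi k), rfl⟩
    · rintro ⟨j, hj, rfl⟩
      exact ⟨mem_range_self j, by rw [dist_comm]; exact le_antisymm (hj i) (hi j)⟩
  constructor
  · rintro ⟨⟨_, hp⟩, x, r, hr, rfl⟩
    obtain ⟨⟨i, rfl⟩, hi⟩ := hp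
    rw [dist_comm] at hi
    have hmem : i ∈ nearestSites P x := fun j => by
      rw [hi, dist_comm]
      exact hr _ (mem_range_self j)
    exact ⟨x, ⟨i, hmem⟩, hsphere x r i hmem hi⟩
  · rintro ⟨x, ⟨i, hi⟩, rfl⟩
    refine ⟨⟨_, mem_image_of_mem P hi⟩, x, dist x (P i), ?_, (hsphere x _ i hi rfl).symm⟩
    rintro _ ⟨j, rfl⟩
    rw [dist_comm _ x]
    exact hi j

theorem finrank_siteOrthogonal_of_ncard_eq_three (hI : AffineIndependent ℝ fun i : I => P i)
    (h : I.ncard = 3) : Module.finrank ℝ (siteOrthogonal P I) = 1 := by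
  have hrank := finrank_siteOrthogonal_add_ncard (finite_of_ncard_pos (by omega))
    (nonempty_of_ncard_ne_zero (by omega)) hI
  rw [finrank_euclideanSpace_fin] at hrank
  omega

theorem isSegment_voronoiFace_inter
    (hind : AffineIndependent ℝ fun i : ↥(nearestSites P x ∩ nearestSites P y) => P i)
    (hcard : (nearestSites P x ∩ nearestSites P y).ncard = 3) (hi : i ∈ nearestSites P x)
    (hi' : i ∉ nearestSites P y) (hj : j ∈ nearestSites P y) (hj' : j ∉ nearestSites P x) :
    IsSegment (voronoiFace P (nearestSites P x ∩ nearestSites P y)) :=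
  ⟨x, y, fun h => hi' (h ▸ hi), voronoiFace_inter_eq_segment
    (finrank_siteOrthogonal_of_ncard_eq_three hind hcard)
    (nonempty_of_ncard_ne_zero (by omega)) hi hi' hj hj'⟩

theorem affDim_voronoiFace_add_ncard (hP : Tendsto P cofinite (Bornology.cobounded E3))
    (hind : AffineIndependent ℝ fun i : nearestSites P x => P i)
    (hx : (nearestSites P x).Nonempty) :
    affDim (voronoiFace P (nearestSites P x)) + (nearestSites P x).ncard = 4 := by
  rw [affDim, vectorSpan_voronoiFace hP,
    finrank_siteOrthogonal_add_ncard (nearestSites_finite hP x) hx hind,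
    finrank_euclideanSpace_fin]

theorem isFace_voronoiFace_iff (hP : Tendsto P cofinite (Bornology.cobounded E3))
    (hind : ∀ x, AffineIndependent ℝ fun i : nearestSites P x => P i) (hJ : J.Nonempty)
    {B : Set E3} {k : ℕ} :
    IsFace (voronoiFace P J) B k ↔ ∃ x, J ⊆ nearestSites P x ∧
      B = voronoiFace P (nearestSites P x) ∧ k + (nearestSites P x).ncard = 4 := by
  constructor
  · rintro ⟨hB, hexp, rfl⟩
    obtain ⟨x, hx, rfl⟩ := exists_eq_voronoiFace_of_isExposed hP hJ hB hexp
    exact ⟨x, hx, rfl, affDim_voronoiFace_add_ncard hP (hind x) (hJ.mono hx)⟩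
  · rintro ⟨x, hx, rfl, hk⟩
    have hdim := affDim_voronoiFace_add_ncard hP (hind x) (hJ.mono hx)
    exact ⟨⟨x, mem_voronoiFace_nearestSites P x⟩,
      isExposed_voronoiFace hJ (nearestSites_finite hP x) hx, by omega⟩

end Space

/-! ### Trigonometric polynomials of degree one -/

section Trigonometry

theorem sin_add_sin_add_sin_eq (x y z : ℝ) : sin (y - x) + sin (z - y) + sin (x - z) =
    4 * (sin ((y - x) / 2) * sin ((z - y) / 2) * sin ((z - x) / 2)) := by
  obtain ⟨p, rfl⟩ : ∃ p, y = x + 2 * p := ⟨(y - x) / 2, by ring⟩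
  obtain ⟨q, rfl⟩ : ∃ q, z = x + 2 * p + 2 * q := ⟨(z - (x + 2 * p)) / 2, by ring⟩
  rw [show x + 2 * p - x = 2 * p by ring, show x + 2 * p + 2 * q - (x + 2 * p) = 2 * q by ring,
    show x - (x + 2 * p + 2 * q) = -(2 * (p + q)) by ring,
    show x + 2 * p + 2 * q - x = 2 * (p + q) by ring]
  simp only [mul_div_cancel_left₀ _ (two_ne_zero' ℝ)]
  rw [sin_neg, sin_two_mul, sin_two_mul, sin_two_mul, sin_add, cos_add]
  linear_combination (-2 * sin p * cos p) * sin_sq_add_cos_sq q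
    + (-2 * sin q * cos q) * sin_sq_add_cos_sq p

theorem sin_add_sin_add_sin_pos {x y z : ℝ} (hxy : x < y) (hyz : y < z) (hzx : z < x + 2 * π) :
    0 < sin (y - x) + sin (z - y) + sin (x - z) := by
  rw [sin_add_sin_add_sin_eq]
  have h1 : 0 < sin ((y - x) / 2) := sin_pos_of_pos_of_lt_pi (by linarith) (by linarith)
  have h2 : 0 < sin ((z - y) / 2) := sin_pos_of_pos_of_lt_pi (by linarith) (by linarith)
  have h3 : 0 < sin ((z - x) / 2) := sin_pos_of_pos_of_lt_pi (by linarith) (by linarith)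
  positivity

variable {b c e x y z w : ℝ}

-- Four points of the plane satisfy an affine dependence; for points of the circle in cyclic order
-- its coefficients are the areas `sin_add_sin_add_sin_pos`, with alternating signs.
theorem trig_no_alternation (hxy : x < y) (hyz : y < z) (hzw : z < w)
    (hwx : w < x + 2 * π) (hx : b * cos x + c * sin x + e ≤ 0)
    (hy : 0 ≤ b * cos y + c * sin y + e) (hz : b * cos z + c * sin z + e ≤ 0)
    (hw : 0 < b * cos w + c * sin w + e) : False := by
  have d1 := sin_add_sin_add_sin_pos hyz hzw (by linarith)
  have d2 := sin_add_sin_add_sin_pos (hxy.trans hyz) hzw (by linarith)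
  have d3 := sin_add_sin_add_sin_pos hxy (hyz.trans hzw) (by linarith)
  have d4 := sin_add_sin_add_sin_pos hxy hyz (by linarith)
  have hdep : (sin (z - y) + sin (w - z) + sin (y - w)) * (b * cos x + c * sin x + e)
      - (sin (z - x) + sin (w - z) + sin (x - w)) * (b * cos y + c * sin y + e)
      + (sin (y - x) + sin (w - y) + sin (x - w)) * (b * cos z + c * sin z + e)
      - (sin (y - x) + sin (z - y) + sin (x - z)) * (b * cos w + c * sin w + e) = 0 := by
    simp only [sin_sub]
    ring
  nlinarith [mul_nonneg d1.le (neg_nonneg.2 hx), mul_nonneg d2.le hy,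
    mul_nonneg d3.le (neg_nonneg.2 hz), mul_pos d4 hw]

theorem trig_eq_zero_of_three_zeros (hxy : x < y) (hyz : y < z) (hzx : z < x + 2 * π)
    (hx : b * cos x + c * sin x + e = 0) (hy : b * cos y + c * sin y + e = 0)
    (hz : b * cos z + c * sin z + e = 0) : b = 0 ∧ c = 0 ∧ e = 0 := by
  have hdet := (sin_add_sin_add_sin_pos hxy hyz hzx).ne'
  have hb : b * (sin (y - x) + sin (z - y) + sin (x - z)) = 0 := by
    simp only [sin_sub]
    linear_combination (sin y - sin z) * hx + (sin z - sin x) * hy + (sin x - sin y) * hz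
  have hc : c * (sin (y - x) + sin (z - y) + sin (x - z)) = 0 := by
    simp only [sin_sub]
    linear_combination (cos z - cos y) * hx + (cos x - cos z) * hy + (cos y - cos x) * hz
  have he : e * (sin (y - x) + sin (z - y) + sin (x - z)) = 0 := by
    simp only [sin_sub]
    linear_combination (cos y * sin z - sin y * cos z) * hx
      + (cos z * sin x - sin z * cos x) * hy + (cos x * sin y - sin x * cos y) * hz
  exact ⟨(mul_eq_zero.1 hb).resolve_right hdet, (mul_eq_zero.1 hc).resolve_right hdet,
    (mul_eq_zero.1 he).resolve_right hdet⟩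

theorem mul_sin_lt_mul_sin (hx : 0 < x) (hxy : x < y) (hy : y ≤ π) : x * sin y < y * sin x := by
  have hy0 : 0 < y := hx.trans hxy
  have h := strictConcaveOn_sin_Icc.2 (left_mem_Icc.2 pi_pos.le) ⟨hy0.le, hy⟩ hy0.ne
    (sub_pos.2 ((div_lt_one hy0).2 hxy)) (div_pos hx hy0) (sub_add_cancel 1 (x / y))
  simp only [smul_eq_mul, sin_zero, mul_zero, zero_add, div_mul_cancel₀ x hy0.ne'] at h
  rw [div_mul_eq_mul_div, div_lt_iff₀ hy0] at h
  linarith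

theorem sin_pi_mul_div_eq_zero_iff {n : ℕ} (hn : n ≠ 0) (m : ℤ) :
    sin (π * m / n) = 0 ↔ (n : ℤ) ∣ m := by
  rw [sin_eq_zero_iff]
  refine exists_congr fun k => ?_
  rw [eq_div_iff (by positivity), mul_right_comm, mul_comm _ π, mul_right_inj' pi_ne_zero]
  norm_cast
  rw [eq_comm, mul_comm]

theorem sin_mul_sin_succ_nonneg {n : ℕ} (hn : n ≠ 0) (m : ℤ) :
    0 ≤ sin (π * m / n) * sin (π * (m + 1) / n) := by
  have hn0 : (0 : ℤ) < n := by positivity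
  have hn' : (0 : ℝ) < n := by positivity
  have hr := m.emod_nonneg hn0.ne'
  have hrn := m.emod_lt_of_pos hn0
  rw [← m.emod_add_mul_ediv n]
  generalize m % n = r at hr hrn ⊢
  generalize m / (n : ℤ) = q
  have _ : (0 : ℝ) ≤ r := by exact_mod_cast hr
  have hrn' : (r : ℝ) + 1 ≤ n := by exact_mod_cast hrn
  have e1 : π * ((r + n * q : ℤ) : ℝ) / n = π * r / n + q * π := by
    push_cast
    field_simp
  have e2 : π * (((r + n * q : ℤ) : ℝ) + 1) / n = π * (r + 1) / n + q * π := by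
    push_cast
    field_simp
    ring
  have h1 : 0 ≤ sin (π * r / n) := by
    refine sin_nonneg_of_nonneg_of_le_pi (by positivity) ?_
    rw [div_le_iff₀ hn']
    gcongr
    linarith
  have h2 : 0 ≤ sin (π * (r + 1) / n) := by
    refine sin_nonneg_of_nonneg_of_le_pi (by positivity) ?_
    rw [div_le_iff₀ hn']
    gcongr
  rw [e1, e2, sin_add_int_mul_pi, sin_add_int_mul_pi, mul_mul_mul_comm, ← mul_zpow]
  simpa only [neg_one_mul, neg_neg, one_zpow, one_mul] using mul_nonneg h1 h2

theorem cos_sub_cos_odd_mul {n : ℕ} (m : ℤ) :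
    cos (π / n) - cos (π * (2 * m + 1) / n) =
      2 * (sin (π * m / n) * sin (π * (m + 1) / n)) := by
  rw [cos_sub_cos, ← neg_sub, neg_div, sin_neg]
  ring_nf

theorem cos_odd_mul_le {n : ℕ} (hn : n ≠ 0) (m : ℤ) : cos (π * (2 * m + 1) / n) ≤ cos (π / n) := by
  have h := sin_mul_sin_succ_nonneg hn m
  have h' := cos_sub_cos_odd_mul (n := n) m
  linarith

theorem cos_odd_mul_eq_iff {n : ℕ} (hn : n ≠ 0) (m : ℤ) :
    cos (π * (2 * m + 1) / n) = cos (π / n) ↔ (n : ℤ) ∣ m ∨ (n : ℤ) ∣ m + 1 := by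
  have h := sin_pi_mul_div_eq_zero_iff hn (m + 1)
  push_cast at h
  rw [eq_comm, ← sub_eq_zero, cos_sub_cos_odd_mul, ← sin_pi_mul_div_eq_zero_iff hn, ← h,
    mul_eq_zero_iff_left two_ne_zero, mul_eq_zero]

end Trigonometry

/-! ### Real functions -/

section RealFunctions

theorem exists_hasDerivAt_nonneg {f f' : ℝ → ℝ} (hf : ∀ t, HasDerivAt f (f' t) t) {a b : ℝ}
    (hab : a < b) (h : f a ≤ f b) : ∃ c, a < c ∧ c < b ∧ 0 ≤ f' c := by
  obtain ⟨c, hc, e⟩ := exists_hasDerivAt_eq_slope f f' hab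
    (fun t _ => (hf t).continuousAt.continuousWithinAt) (fun t _ => hf t)
  exact ⟨c, hc.1, hc.2, e ▸ div_nonneg (by linarith) (by linarith)⟩

theorem exists_hasDerivAt_nonpos {f f' : ℝ → ℝ} (hf : ∀ t, HasDerivAt f (f' t) t) {a b : ℝ}
    (hab : a < b) (h : f b ≤ f a) : ∃ c, a < c ∧ c < b ∧ f' c ≤ 0 := by
  obtain ⟨c, hac, hcb, hc⟩ := exists_hasDerivAt_nonneg (fun t => (hf t).neg) hab (neg_le_neg h)
  exact ⟨c, hac, hcb, neg_nonneg.1 hc⟩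

theorem exists_hasDerivAt_pos {f f' : ℝ → ℝ} (hf : ∀ t, HasDerivAt f (f' t) t) {a b : ℝ}
    (hab : a < b) (h : f a < f b) : ∃ c, a < c ∧ c < b ∧ 0 < f' c := by
  obtain ⟨c, hc, e⟩ := exists_hasDerivAt_eq_slope f f' hab
    (fun t _ => (hf t).continuousAt.continuousWithinAt) (fun t _ => hf t)
  exact ⟨c, hc.1, hc.2, e ▸ div_pos (by linarith) (by linarith)⟩

variable {B ξ u₁ u₂ : ℝ}

theorem hasDerivAt_sq_add_mul_cos (B u : ℝ) :
    HasDerivAt (fun u => u ^ 2 + B * cos u) (2 * u - B * sin u) u := by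
  refine ((hasDerivAt_pow 2 u).add ((hasDerivAt_cos u).const_mul B)).congr_deriv ?_
  push_cast
  ring

theorem strictAntiOn_sq_add_mul_cos (hξ : 0 < ξ) (hξπ : ξ < π) (hB : 2 * ξ - B * sin ξ = 0) :
    StrictAntiOn (fun u => u ^ 2 + B * cos u) (Icc 0 ξ) := by
  refine strictAntiOn_of_deriv_neg (convex_Icc _ _) (by fun_prop) fun u hu => ?_
  rw [interior_Icc] at hu
  rw [(hasDerivAt_sq_add_mul_cos B u).deriv]
  have hlt := mul_sin_lt_mul_sin hu.1 hu.2 hξπ.le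
  have hsin := sin_pos_of_pos_of_lt_pi hξ hξπ
  refine neg_of_mul_neg_left (b := sin ξ) ?_ hsin.le
  linear_combination sin u * hB + 2 * hlt

theorem strictMonoOn_sq_add_mul_cos (hξ : 0 < ξ) (hξπ : ξ < π) (hB : 2 * ξ - B * sin ξ = 0) :
    StrictMonoOn (fun u => u ^ 2 + B * cos u) (Icc ξ π) := by
  refine strictMonoOn_of_deriv_pos (convex_Icc _ _) (by fun_prop) fun u hu => ?_
  rw [interior_Icc] at hu
  rw [(hasDerivAt_sq_add_mul_cos B u).deriv]
  have hlt := mul_sin_lt_mul_sin hξ hu.1 hu.2.le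
  have hsin := sin_pos_of_pos_of_lt_pi hξ hξπ
  refine pos_of_mul_pos_left (b := sin ξ) ?_ hsin.le
  linear_combination -sin u * hB + 2 * hlt

theorem lt_sq_add_mul_cos_of_mem_Icc (h1 : 0 ≤ u₁) (h12 : u₁ < u₂) (h2 : u₂ ≤ π)
    (hB : u₁ ^ 2 + B * cos u₁ = u₂ ^ 2 + B * cos u₂) {u : ℝ} (hu : u ∈ Icc 0 π)
    (h : u < u₁ ∨ u₂ < u) : u₂ ^ 2 + B * cos u₂ < u ^ 2 + B * cos u := by
  obtain ⟨ξ, ⟨hξ1, hξ2⟩, hξ⟩ := exists_hasDerivAt_eq_zero (f := fun u => u ^ 2 + B * cos u) h12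
    (by fun_prop) hB fun u _ => hasDerivAt_sq_add_mul_cos B u
  have hξ0 := h1.trans_lt hξ1
  have hξπ := hξ2.trans_le h2
  rcases h with h | h
  · rw [← hB]
    exact strictAntiOn_sq_add_mul_cos hξ0 hξπ hξ ⟨hu.1, (h.trans hξ1).le⟩ ⟨h1, hξ1.le⟩ h
  · exact strictMonoOn_sq_add_mul_cos hξ0 hξπ hξ ⟨hξ2.le, h2⟩ ⟨(hξ2.trans h).le, hu.2⟩ h

theorem exists_sq_add_mul_cos_minimal_outside (h1 : 0 ≤ u₁) (h12 : u₁ < u₂) (h2 : u₂ ≤ π) :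
    ∃ B : ℝ, (∀ u, |u| = u₁ ∨ |u| = u₂ → u ^ 2 + B * cos u = u₂ ^ 2 + B * cos u₂) ∧
      ∀ u, |u| < u₁ ∨ u₂ < |u| → u₂ ^ 2 + B * cos u₂ < u ^ 2 + B * cos u := by
  have hcos : 0 < cos u₁ - cos u₂ := sub_pos.2 (cos_lt_cos_of_nonneg_of_le_pi h1 h2 h12)
  set B := (u₂ ^ 2 - u₁ ^ 2) / (cos u₁ - cos u₂)
  have hB0 : 0 < B := div_pos (sub_pos.2 (by gcongr)) hcos
  have hB : u₁ ^ 2 + B * cos u₁ = u₂ ^ 2 + B * cos u₂ := by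
    linear_combination div_mul_cancel₀ (u₂ ^ 2 - u₁ ^ 2) hcos.ne'
  refine ⟨B, fun u h => ?_, fun u h => ?_⟩ <;> rw [← sq_abs u, ← cos_abs u]
  · rcases h with h | h <;> rw [h]
    exact hB
  · have hu := abs_nonneg u
    generalize |u| = u at h hu ⊢
    -- Beyond `π`, compare `u` with the angle `w` in `[0, π]` having the same cosine.
    obtain ⟨w, hw, hwu, hcosw⟩ : ∃ w ∈ Icc 0 π, w ≤ u ∧ cos w = cos u := by
      rcases le_total u π with hπ | hπ
      · exact ⟨u, ⟨hu, hπ⟩, le_rfl, rfl⟩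
      · exact ⟨arccos (cos u), ⟨arccos_nonneg _, arccos_le_pi _⟩, (arccos_le_pi _).trans hπ,
          cos_arccos (neg_one_le_cos u) (cos_le_one u)⟩
    rw [← hcosw]
    by_cases hout : w < u₁ ∨ u₂ < w
    · refine (lt_sq_add_mul_cos_of_mem_Icc h1 h12 h2 hB hw hout).trans_le ?_
      gcongr
      exact hw.1
    · push Not at hout
      have hcosle : cos u₂ ≤ cos w := cos_le_cos_of_nonneg_of_le_pi hw.1 h2 hout.2
      have hu2 : u₂ < u := h.resolve_left (by linarith)
      exact add_lt_add_of_lt_of_le (pow_lt_pow_left₀ hu2 (h1.trans h12.le) two_ne_zero) (by gcongr)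

end RealFunctions

/-! ### The helix -/

section Helix

theorem inner_helix (τ : ℝ) (v : E3) :
    inner ℝ (helix τ) v = v 0 * τ + v 1 * cos τ + v 2 * sin τ := by
  simp [helix, PiLp.inner_apply, Fin.sum_univ_three]

theorem norm_sq_helix (τ : ℝ) : ‖helix τ‖ ^ 2 = τ ^ 2 + 1 := by
  simp [helix, EuclideanSpace.real_norm_sq_eq, Fin.sum_univ_three, add_assoc]

theorem sitePower_helix (τ : ℝ) (x : E3) :
    sitePower (helix τ) x = τ ^ 2 + 1 - 2 * (x 0 * τ + x 1 * cos τ + x 2 * sin τ) := by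
  rw [sitePower, norm_sq_helix, inner_helix]

theorem hasDerivAt_inner_helix (v : E3) (τ : ℝ) :
    HasDerivAt (fun τ => inner ℝ (helix τ) v) (v 0 - v 1 * sin τ + v 2 * cos τ) τ := by
  simp only [inner_helix]
  refine ((((hasDerivAt_id τ).const_mul (v 0)).add ((hasDerivAt_cos τ).const_mul (v 1))).add
    ((hasDerivAt_sin τ).const_mul (v 2))).congr_deriv ?_
  ring

theorem hasDerivAt_sitePower_helix (x : E3) (τ : ℝ) :
    HasDerivAt (fun τ => sitePower (helix τ) x)
      (2 * τ - 2 * (x 0 - x 1 * sin τ + x 2 * cos τ)) τ := by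
  simp only [sitePower, norm_sq_helix]
  refine (((hasDerivAt_pow 2 τ).add_const 1).sub
    ((hasDerivAt_inner_helix x τ).const_mul 2)).congr_deriv ?_
  push_cast
  ring

theorem hasDerivAt_deriv_sitePower_helix (x : E3) (τ : ℝ) :
    HasDerivAt (fun τ => 2 * τ - 2 * (x 0 - x 1 * sin τ + x 2 * cos τ))
      (2 * x 1 * cos τ + 2 * x 2 * sin τ + 2) τ := by
  refine (((hasDerivAt_id τ).const_mul 2).sub
    ((((hasDerivAt_const τ (x 0)).sub ((hasDerivAt_sin τ).const_mul (x 1))).add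
      ((hasDerivAt_cos τ).const_mul (x 2))).const_mul 2)).congr_deriv ?_
  ring

theorem sitePower_helix_no_alternation (x : E3) (r : ℝ) {t₀ t₁ t₂ t₃ t₄ : ℝ} (h01 : t₀ < t₁)
    (h12 : t₁ < t₂) (h23 : t₂ < t₃) (h34 : t₃ < t₄) (h40 : t₄ ≤ t₀ + 2 * π)
    (h0 : sitePower (helix t₀) x ≤ r) (h1 : r ≤ sitePower (helix t₁) x)
    (h2 : sitePower (helix t₂) x ≤ r) (h3 : r ≤ sitePower (helix t₃) x)
    (h4 : sitePower (helix t₄) x ≤ r) : False := by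
  have df := hasDerivAt_sitePower_helix x
  have df' := hasDerivAt_deriv_sitePower_helix x
  obtain ⟨s₀, a0, b0, c0⟩ := exists_hasDerivAt_nonneg df h01 (h0.trans h1)
  obtain ⟨s₁, a1, b1, c1⟩ := exists_hasDerivAt_nonpos df h12 (h2.trans h1)
  obtain ⟨s₂, a2, b2, c2⟩ := exists_hasDerivAt_nonneg df h23 (h2.trans h3)
  obtain ⟨s₃, a3, b3, c3⟩ := exists_hasDerivAt_nonpos df h34 (h4.trans h3)
  -- The fourth alternation of the second derivative comes from the gain `4π` of the first one over
  -- a turn.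
  have hperiod : 0 < 2 * (s₀ + 2 * π) -
      2 * (x 0 - x 1 * sin (s₀ + 2 * π) + x 2 * cos (s₀ + 2 * π)) := by
    rw [sin_add_two_pi, cos_add_two_pi]
    linarith [pi_pos]
  obtain ⟨u₀, p0, q0, r0⟩ := exists_hasDerivAt_nonpos df' (b0.trans a1) (c1.trans c0)
  obtain ⟨u₁, p1, q1, r1⟩ := exists_hasDerivAt_nonneg df' (b1.trans a2) (c1.trans c2)
  obtain ⟨u₂, p2, q2, r2⟩ := exists_hasDerivAt_nonpos df' (b2.trans a3) (c3.trans c2)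
  obtain ⟨u₃, p3, q3, r3⟩ := exists_hasDerivAt_pos df' (by linarith) (c3.trans_lt hperiod)
  exact trig_no_alternation (q0.trans p1) (q1.trans p2) (q2.trans p3) (by linarith) r0 r1 r2 r3

theorem eq_zero_of_inner_helix_eq {f : Fin 4 → ℝ} (hf : StrictMono f) (h : f 3 ≤ f 0 + 2 * π)
    {v : E3} (hv : ∀ i j, inner ℝ (helix (f i)) v = inner ℝ (helix (f j)) v) : v = 0 := by
  have rolle : ∀ i j, i < j → ∃ c ∈ Ioo (f i) (f j), v 2 * cos c + -v 1 * sin c + v 0 = 0 := by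
    intro i j hij
    obtain ⟨c, hc, h⟩ := exists_hasDerivAt_eq_zero (hf hij)
      (fun τ _ => (hasDerivAt_inner_helix v τ).continuousAt.continuousWithinAt) (hv i j)
      fun τ _ => hasDerivAt_inner_helix v τ
    exact ⟨c, hc, by linarith⟩
  obtain ⟨x, hx, hx0⟩ := rolle 0 1 (by decide)
  obtain ⟨y, hy, hy0⟩ := rolle 1 2 (by decide)
  obtain ⟨z, hz, hz0⟩ := rolle 2 3 (by decide)
  obtain ⟨h2, h1, h0⟩ := trig_eq_zero_of_three_zeros (hx.2.trans hy.1) (hy.2.trans hz.1)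
    (by linarith [hx.1, hz.2]) hx0 hy0 hz0
  ext i
  fin_cases i
  exacts [h0, neg_eq_zero.1 h1, h2]

theorem affineIndependent_helix_of_strictMono {f : Fin 4 → ℝ} (hf : StrictMono f)
    (h : f 3 ≤ f 0 + 2 * π) : AffineIndependent ℝ fun i => helix (f i) := by
  rw [affineIndependent_iff_finrank_vectorSpan_eq ℝ _ (n := 3) (Fintype.card_fin 4)]
  have hbot : siteOrthogonal (fun i => helix (f i)) univ = ⊥ := by
    refine (Submodule.eq_bot_iff _).2 fun v hv => eq_zero_of_inner_helix_eq hf h fun i j => ?_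
    exact mem_siteOrthogonal_iff.1 hv i (mem_univ i) j (mem_univ j)
  rw [siteOrthogonal, Submodule.orthogonal_eq_bot_iff, image_univ] at hbot
  rw [hbot, finrank_top, finrank_euclideanSpace_fin]

theorem affineIndependent_helix {ι : Type*} [Finite ι] (hι : Nat.card ι ≤ 4) {τ : ι → ℝ}
    (hτ : Function.Injective τ) {t : ℝ} (ht : ∀ i, τ i ∈ Icc t (t + 2 * π)) :
    AffineIndependent ℝ fun i => helix (τ i) := by
  have hcard : (range τ).encard ≤ (4 : ℕ) := by
    rw [← image_univ, hτ.encard_image, encard_univ, ENat.card_eq_coe_natCard]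
    exact_mod_cast hι
  have hinf : (Icc t (t + 2 * π)).encard = ⊤ :=
    encard_eq_top (Icc_infinite (lt_add_of_pos_right t two_pi_pos))
  obtain ⟨s, hτs, hst, hs⟩ := exists_superset_subset_encard_eq (range_subset_iff.2 ht) hcard
    (le_top.trans_eq hinf.symm)
  lift s to Finset ℝ using finite_of_encard_eq_coe hs
  rw [encard_coe_eq_coe_finsetCard, Nat.cast_inj] at hs
  obtain ⟨e⟩ : Nonempty (Fin 4 ≃o s) := ⟨s.orderIsoOfFin hs⟩
  have hle : (e 3 : ℝ) ≤ e 0 + 2 * π := by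
    linarith [(hst (e 3).2).2, (hst (e 0).2).1]
  have hind : AffineIndependent ℝ fun σ : s => helix σ :=
    (affineIndependent_equiv e.toEquiv).1
      (affineIndependent_helix_of_strictMono (f := fun i => e i) e.strictMono hle)
  obtain ⟨g, hg⟩ : ∃ g : ι ↪ s, ∀ i, (g i : ℝ) = τ i :=
    ⟨⟨fun i => ⟨τ i, hτs (mem_range_self i)⟩, fun i j h => hτ (congrArg Subtype.val h)⟩,
      fun i => rfl⟩
  simpa only [Function.comp_def, hg] using hind.comp_embedding g

end Helix

/-! ### Nearest sites on the helix -/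

section HelixSites

variable {n : ℕ} {x : E3}

/-- The parameter `2πs/n` of the site `h_n(s)` along the helix. -/
noncomputable def helixAngle (n : ℕ) (s : ℤ) : ℝ := 2 * π * s / n

theorem helix_helixAngle (n : ℕ) (s : ℤ) : helix (helixAngle n s) = helixPt n s := rfl

theorem helixAngle_strictMono (hn : n ≠ 0) : StrictMono (helixAngle n) := fun s r h => by
  unfold helixAngle
  gcongr

theorem helixAngle_add_self (hn : n ≠ 0) (s : ℤ) :
    helixAngle n (s + n) = helixAngle n s + 2 * π := by
  unfold helixAngle
  push_cast
  field_simp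

theorem helixPt_injective (hn : n ≠ 0) : Function.Injective (helixPt n) := fun s r h => by
  rw [← helix_helixAngle, ← helix_helixAngle] at h
  have h0 := congrArg (fun p : E3 => p 0) h
  simp only [helix, PiLp.toLp_apply, Matrix.cons_val_zero] at h0
  exact (helixAngle_strictMono hn).injective h0

theorem tendsto_helixPt_cobounded (hn : n ≠ 0) :
    Tendsto (helixPt n) cofinite (Bornology.cobounded E3) := by
  rw [← tendsto_norm_atTop_iff_cobounded]
  have hangle : Tendsto (fun s : ℤ => 2 * π / n * ‖(s : ℝ)‖) cofinite atTop :=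
    (tendsto_norm_cocompact_atTop.comp Int.tendsto_coe_cofinite).const_mul_atTop (by positivity)
  refine tendsto_atTop_mono (fun s => ?_) hangle
  have hpos : 0 ≤ 2 * π / n := by positivity
  have heq : 2 * π / n * ‖(s : ℝ)‖ = ‖helixPt n s 0‖ := by
    rw [← abs_of_nonneg hpos, Real.norm_eq_abs, Real.norm_eq_abs, ← abs_mul, div_mul_eq_mul_div]
    rfl
  exact heq.trans_le (PiLp.norm_apply_le _ 0)

theorem sitePower_helixPt_add_self (hn : n ≠ 0) (s : ℤ) (x : E3) :
    sitePower (helixPt n (s + n)) x =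
      sitePower (helixPt n s) x + 4 * π * (helixAngle n s + π - x 0) := by
  rw [← helix_helixAngle, ← helix_helixAngle, helixAngle_add_self hn, sitePower_helix,
    sitePower_helix, cos_add_two_pi, sin_add_two_pi]
  ring

theorem sitePower_helixPt_period_lt (hn : n ≠ 0) {s r : ℤ} (h : s < r) (x : E3) :
    sitePower (helixPt n (s + n)) x - sitePower (helixPt n s) x <
      sitePower (helixPt n (r + n)) x - sitePower (helixPt n r) x := by
  have hangle := mul_lt_mul_of_pos_left (helixAngle_strictMono hn h) pi_pos
  rw [sitePower_helixPt_add_self hn, sitePower_helixPt_add_self hn]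
  linarith

theorem sub_le_of_mem_nearestSites (hn : n ≠ 0) {i j : ℤ} (hi : i ∈ nearestSites (helixPt n) x)
    (hj : j ∈ nearestSites (helixPt n) x) : j - i ≤ n := by
  by_contra! h
  have hi' := mem_nearestSites_iff.1 hi (i + n)
  have hj' := mem_nearestSites_iff.1 hj (j - n)
  have hlt := sitePower_helixPt_period_lt hn (show i < j - n by omega) x
  rw [sub_add_cancel] at hlt
  linarith

theorem mem_nearestSites_of_forall_abs_sub_le (hn : n ≠ 0) {p : ℤ}
    (h : ∀ s, |s - p| ≤ n → sitePower (helixPt n p) x ≤ sitePower (helixPt n s) x) :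
    p ∈ nearestSites (helixPt n) x := by
  obtain ⟨q, hq⟩ := nearestSites_nonempty (tendsto_helixPt_cobounded hn) x
  refine mem_nearestSites_of_le hq (h q (abs_le.2 ⟨?_, ?_⟩))
  · by_contra! hlt
    have hdown := h (p - n) (by simp)
    have hup := mem_nearestSites_iff.1 hq (q + n)
    have hperiod := sitePower_helixPt_period_lt hn (show q < p - n by omega) x
    rw [sub_add_cancel] at hperiod
    linarith
  · by_contra! hlt
    have hup := h (p + n) (by simp)
    have hdown := mem_nearestSites_iff.1 hq (q - n)
    have hperiod := sitePower_helixPt_period_lt hn (show p < q - n by omega) x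
    rw [sub_add_cancel] at hperiod
    linarith

theorem nearestSites_helixPt_no_alternation (hn : n ≠ 0) {a b c d e : ℤ} (hab : a < b)
    (hbc : b < c) (hcd : c < d) (hde : d < e) (ha : a ∈ nearestSites (helixPt n) x)
    (hc : c ∈ nearestSites (helixPt n) x) (he : e ∈ nearestSites (helixPt n) x) : False := by
  have hmono := helixAngle_strictMono hn
  have hle : helixAngle n e ≤ helixAngle n a + 2 * π := by
    rw [← helixAngle_add_self hn]
    exact hmono.monotone (by linarith [sub_le_of_mem_nearestSites hn ha he])
  exact sitePower_helix_no_alternation x (sitePower (helixPt n a) x) (hmono hab) (hmono hbc)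
    (hmono hcd) (hmono hde) hle le_rfl (mem_nearestSites_iff.1 ha b) (sitePower_eq_of_mem hc ha).le
    (mem_nearestSites_iff.1 ha d) (sitePower_eq_of_mem he ha).le

theorem eq_add_one_or_eq_add_one_of_mem_nearestSites (hn : n ≠ 0) {p q r : ℤ} (hpq : p < q)
    (hqr : q < r) (hp : p ∈ nearestSites (helixPt n) x) (hq : q ∈ nearestSites (helixPt n) x)
    (hr : r ∈ nearestSites (helixPt n) x) : q = p + 1 ∨ r = q + 1 := by
  by_contra! h
  exact nearestSites_helixPt_no_alternation hn (lt_add_one p) (lt_of_le_of_ne hpq h.1.symm)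
    (lt_add_one q) (lt_of_le_of_ne hqr h.2.symm) hp hq hr

theorem exists_orderEmb_of_le_ncard {α : Type*} [LinearOrder α] {S : Set α} {k : ℕ}
    (h : k ≤ S.ncard) : ∃ f : Fin k ↪o α, ∀ i, f i ∈ S := by
  obtain ⟨T, hTS, hT⟩ := Set.exists_subset_card_eq h
  rcases eq_or_ne k 0 with rfl | hk
  · exact ⟨⟨⟨Fin.elim0, fun i => i.elim0⟩, fun {i} => i.elim0⟩, fun i => i.elim0⟩
  lift T to Finset α using finite_of_ncard_ne_zero (hT.trans_ne hk)
  rw [ncard_coe_finset] at hT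
  exact ⟨T.orderEmbOfFin hT, fun i => hTS (T.orderEmbOfFin_mem hT i)⟩

theorem ncard_nearestSites_helixPt_le (hn : n ≠ 0) (x : E3) :
    (nearestSites (helixPt n) x).ncard ≤ 4 := by
  by_contra! h
  obtain ⟨f, hf⟩ := exists_orderEmb_of_le_ncard (show 5 ≤ (nearestSites (helixPt n) x).ncard from h)
  have hlt : ∀ i j, i < j → f i < f j := fun i j => f.strictMono.lt_iff_lt.2
  exact nearestSites_helixPt_no_alternation hn (hlt 0 1 (by decide)) (hlt 1 2 (by decide))
    (hlt 2 3 (by decide)) (hlt 3 4 (by decide)) (hf 0) (hf 2) (hf 4)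

theorem ncard_four {α : Type*} [LinearOrder α] {a b c d : α} (hab : a < b) (hbc : b < c)
    (hcd : c < d) : ({a, b, c, d} : Set α).ncard = 4 := by
  rw [ncard_insert_of_notMem (by grind), ncard_insert_of_notMem (by grind), ncard_pair hcd.ne]

theorem nearestSites_helixPt_eq_of_four_mem (hn : n ≠ 0) {a b c d : ℤ} (hab : a < b)
    (hbc : b < c) (hcd : c < d) (h : {a, b, c, d} ⊆ nearestSites (helixPt n) x) :
    nearestSites (helixPt n) x = {a, b, c, d} ∧ b = a + 1 ∧ d = c + 1 ∧ d - a ≤ n := by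
  have ha : a ∈ nearestSites (helixPt n) x := h (by simp)
  have hb : b ∈ nearestSites (helixPt n) x := h (by simp)
  have hc : c ∈ nearestSites (helixPt n) x := h (by simp)
  have hd : d ∈ nearestSites (helixPt n) x := h (by simp)
  refine ⟨?_, ?_, ?_, sub_le_of_mem_nearestSites hn ha hd⟩
  · have hfin := nearestSites_finite (tendsto_helixPt_cobounded hn) x
    refine (eq_of_subset_of_ncard_le h ?_ hfin).symm
    rw [ncard_four hab hbc hcd]
    exact ncard_nearestSites_helixPt_le hn x
  · by_contra hne
    exact nearestSites_helixPt_no_alternation hn (lt_add_one a) (lt_of_le_of_ne hab (Ne.symm hne))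
      hbc hcd ha hb hd
  · by_contra hne
    exact nearestSites_helixPt_no_alternation hn hab hbc (lt_add_one c)
      (lt_of_le_of_ne hcd (Ne.symm hne)) ha hc hd

theorem affineIndependent_nearestSites_helixPt (hn : n ≠ 0) (x : E3) :
    AffineIndependent ℝ fun i : nearestSites (helixPt n) x => helixPt n i := by
  have hmono := helixAngle_strictMono hn
  have hfin := nearestSites_finite (tendsto_helixPt_cobounded hn) x
  obtain ⟨p, hp, hmin⟩ := exists_min_image _ id hfin
    (nearestSites_nonempty (tendsto_helixPt_cobounded hn) x)
  have := hfin.to_subtype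
  refine affineIndependent_helix (τ := fun i : nearestSites (helixPt n) x => helixAngle n i)
    (t := helixAngle n p) ?_
    (hmono.injective.comp Subtype.val_injective) fun i =>
    ⟨hmono.monotone (hmin i i.2), ?_⟩
  · rw [Nat.card_coe_set_eq]
    exact ncard_nearestSites_helixPt_le hn x
  · rw [← helixAngle_add_self hn]
    exact hmono.monotone (by linarith [sub_le_of_mem_nearestSites hn hp i.2])

theorem exists_sitePower_helix_eq (μ B : ℝ) : ∃ x : E3, ∀ τ,
    sitePower (helix τ) x = (τ - μ) ^ 2 + B * cos (τ - μ) + (1 - μ ^ 2) := by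
  refine ⟨!₂[μ, -(B / 2) * cos μ, -(B / 2) * sin μ], fun τ => ?_⟩
  rw [sitePower_helix, cos_sub]
  simp only [Matrix.cons_val]
  ring

theorem abs_helixAngle_sub (hn : n ≠ 0) (s M : ℤ) :
    |helixAngle n s - π * M / n| = π * (|2 * s - M| : ℤ) / n := by
  have hn' : (0 : ℝ) < n := by positivity
  rw [helixAngle, ← sub_div, mul_comm 2 π, mul_assoc, ← mul_sub, abs_div, abs_mul,
    abs_of_pos hn', abs_of_pos pi_pos]
  push_cast
  rfl

-- The sphere is centred on the principal normal at the parameter `πM/n`, about which the helix has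
-- a half-turn symmetry.
theorem exists_nearestSites_helixPt_eq {M e₁ e₂ : ℤ} (h1 : 0 ≤ e₁) (h12 : e₁ < e₂) (h2 : e₂ ≤ n)
    (hgap : ∀ s, |2 * s - M| ≤ e₁ ∨ e₂ ≤ |2 * s - M|)
    (hne : ∃ s, |2 * s - M| = e₁ ∨ |2 * s - M| = e₂) :
    ∃ x, nearestSites (helixPt n) x = {s | |2 * s - M| = e₁ ∨ |2 * s - M| = e₂} := by
  have hn : (0 : ℝ) < n := by exact_mod_cast (h1.trans_lt h12).trans_le h2
  have hmono : StrictMono fun k : ℤ => π * k / n := fun k l h => by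
    have := pi_pos
    simp only
    gcongr
  obtain ⟨B, hB, hB'⟩ := exists_sq_add_mul_cos_minimal_outside (u₁ := π * e₁ / n)
    (u₂ := π * e₂ / n) (by positivity) (hmono h12) (by
      rw [div_le_iff₀ hn]
      gcongr
      exact_mod_cast h2)
  obtain ⟨x, hx⟩ := exists_sitePower_helix_eq (π * M / n) B
  refine ⟨x, nearestSites_eq_of_sitePower hne
    (c := (π * e₂ / n) ^ 2 + B * cos (π * e₂ / n) + (1 - (π * M / n) ^ 2)) (fun s hs => ?_)
    fun s hs => ?_⟩
  · rw [← helix_helixAngle, hx, hB]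
    rw [abs_helixAngle_sub (by omega)]
    exact hs.imp (congrArg fun k : ℤ => π * k / n) (congrArg fun k : ℤ => π * k / n)
  · rw [← helix_helixAngle, hx]
    gcongr ?_ + _
    refine hB' _ ?_
    rw [abs_helixAngle_sub (by omega)]
    have hs' : |2 * s - M| < e₁ ∨ e₂ < |2 * s - M| := by
      rw [mem_ofPred_eq] at hs
      have := hgap s
      omega
    exact hs'.imp (fun h => hmono h) fun h => hmono h

theorem exists_nearestSites_helixPt_eq_pair {p q : ℤ} (hpq : p < q) (h : q - p ≤ n) :
    ∃ x, nearestSites (helixPt n) x = {p, q} := by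
  obtain ⟨x, hx⟩ := exists_nearestSites_helixPt_eq (n := n) (M := p + q) (e₁ := q - p - 1)
    (e₂ := q - p) (by omega) (by omega) h (fun s => by grind) ⟨q, by grind⟩
  exact ⟨x, hx.trans (Set.ext fun s => by grind)⟩

theorem exists_nearestSites_helixPt_eq_four {a c : ℤ} (hac : a + 1 < c) (h : c + 1 - a ≤ n) :
    ∃ x, nearestSites (helixPt n) x = {a, a + 1, c, c + 1} := by
  obtain ⟨x, hx⟩ := exists_nearestSites_helixPt_eq (n := n) (M := a + c + 1) (e₁ := c - a - 1)
    (e₂ := c + 1 - a) (by omega) (by omega) h (fun s => by grind) ⟨c, by grind⟩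
  exact ⟨x, hx.trans (Set.ext fun s => by grind)⟩

end HelixSites

section Delaunay

variable {n : ℕ}

theorem delaunayIsTriangulation_helixSet (hn : n ≠ 0) :
    DelaunayIsTriangulation (helixSet n) := fun T hT => by
  obtain ⟨x, -, rfl⟩ := isDelaunayCell_range_iff.1 hT
  refine ⟨hT, ?_⟩
  rw [image_eq_range]
  exact (affineIndependent_nearestSites_helixPt hn x).range

theorem isDelaunaySimplex_helixSet_four_iff (hn : n ≠ 0) {a b c d : ℤ} (hab : a < b) (hbc : b < c)
    (hcd : c < d) :
    IsDelaunaySimplex (helixSet n) {helixPt n a, helixPt n b, helixPt n c, helixPt n d} ↔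
      b - a = 1 ∧ d - c = 1 ∧ d - a ≤ (n : ℤ) := by
  have himg : ({helixPt n a, helixPt n b, helixPt n c, helixPt n d} : Set E3) =
      helixPt n '' {a, b, c, d} := by
    simp only [image_insert_eq, image_singleton]
  have hcell : IsDelaunayCell (helixSet n) (helixPt n '' {a, b, c, d}) ↔
      ∃ x, nearestSites (helixPt n) x = {a, b, c, d} := by
    rw [helixSet, isDelaunayCell_range_iff]
    refine exists_congr fun x => ⟨fun h => ?_, fun h => ⟨h ▸ insert_nonempty _ _, by rw [h]⟩⟩
    exact ((helixPt_injective hn).image_injective h.2).symm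
  have hsimplex : IsDelaunaySimplex (helixSet n) (helixPt n '' {a, b, c, d}) ↔
      IsDelaunayCell (helixSet n) (helixPt n '' {a, b, c, d}) :=
    ⟨And.left, delaunayIsTriangulation_helixSet hn _⟩
  rw [himg, hsimplex, hcell]
  constructor
  · rintro ⟨x, hx⟩
    obtain ⟨-, h⟩ := nearestSites_helixPt_eq_of_four_mem hn hab hbc hcd hx.ge
    omega
  · rintro ⟨hba, hdc, hda⟩
    obtain rfl : b = a + 1 := by omega
    obtain rfl : d = c + 1 := by omega
    exact exists_nearestSites_helixPt_eq_four hbc (by omega)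

end Delaunay

section OutwardDirection

variable {n : ℕ}

/-- The horizontal unit vector pointing towards the midpoint of the sites `h_n(k)` and `h_n(k + 1)`
in the projection of the helix along its axis. -/
noncomputable def outwardDir (n : ℕ) (k : ℤ) : E3 :=
  !₂[0, cos (π * (2 * k + 1) / n), sin (π * (2 * k + 1) / n)]

theorem outwardDir_ne_zero (n : ℕ) (k : ℤ) : outwardDir n k ≠ 0 := fun h => by
  have h1 : cos (π * (2 * k + 1) / n) = 0 := congrArg (fun v : E3 => v 1) h
  have h2 : sin (π * (2 * k + 1) / n) = 0 := congrArg (fun v : E3 => v 2) h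
  simpa [h1, h2] using sin_sq_add_cos_sq (π * (2 * k + 1) / n)

theorem outwardDir_add_self (hn : n ≠ 0) (k : ℤ) : outwardDir n (k + n) = outwardDir n k := by
  have hangle : π * (2 * ((k + n : ℤ) : ℝ) + 1) / n = π * (2 * k + 1) / n + 2 * π := by
    push_cast
    field_simp
    ring
  rw [outwardDir, hangle, cos_add_two_pi, sin_add_two_pi, outwardDir]

theorem inner_helixPt_outwardDir (n : ℕ) (s k : ℤ) :
    inner ℝ (helixPt n s) (outwardDir n k) =
      cos (π * (2 * ((s - k - 1 : ℤ) : ℝ) + 1) / n) := by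
  have hangle : π * (2 * ((s - k - 1 : ℤ) : ℝ) + 1) / n =
      helixAngle n s - π * (2 * k + 1) / n := by
    rw [helixAngle]
    push_cast
    ring
  rw [hangle, ← helix_helixAngle, inner_helix, cos_sub]
  simp only [outwardDir, Matrix.cons_val]
  ring

theorem inner_helixPt_outwardDir_le (hn : n ≠ 0) (s k : ℤ) :
    inner ℝ (helixPt n s) (outwardDir n k) ≤ cos (π / n) :=
  (inner_helixPt_outwardDir n s k).trans_le (cos_odd_mul_le hn _)

theorem inner_helixPt_outwardDir_eq_iff (hn : n ≠ 0) (s k : ℤ) :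
    inner ℝ (helixPt n s) (outwardDir n k) = cos (π / n) ↔
      (n : ℤ) ∣ s - k - 1 ∨ (n : ℤ) ∣ s - k := by
  rw [inner_helixPt_outwardDir, cos_odd_mul_eq_iff hn, sub_add_cancel]

theorem dvd_iff_of_abs_lt_two_mul {m e : ℤ} (h : |e| < 2 * m) :
    m ∣ e ↔ e = 0 ∨ e = m ∨ e = -m := by
  refine ⟨?_, ?_⟩
  · rintro ⟨c, rfl⟩
    have hm : 0 < m := by linarith [abs_nonneg (m * c)]
    rw [abs_mul, abs_of_pos hm, mul_comm, mul_lt_mul_iff_left₀ hm, abs_lt] at h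
    obtain rfl | rfl | rfl : c = 0 ∨ c = 1 ∨ c = -1 := by omega
    all_goals simp
  · rintro (rfl | rfl | rfl) <;> simp

theorem exists_sep_inner_outwardDir_eq (hn : 3 ≤ n) {q m : ℤ} (hm : m = q + n ∨ m = q + 1 - n) :
    ∃ z, {s ∈ nearestSites (helixPt n) z | inner ℝ (helixPt n s) (outwardDir n q) = cos (π / n)} =
        {q, q + 1, m} ∧
      ∃ i ∈ nearestSites (helixPt n) z, inner ℝ (helixPt n i) (outwardDir n q) ≠ cos (π / n) := by
  have hdvd : ∀ s : ℤ, |s - q| ≤ n → (inner ℝ (helixPt n s) (outwardDir n q) = cos (π / n) ↔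
      s = q ∨ s = q + 1 ∨ s = q + n ∨ s = q - n ∨ s = q + 1 - n) := fun s hs => by
    rw [abs_le] at hs
    rw [inner_helixPt_outwardDir_eq_iff (by omega),
      dvd_iff_of_abs_lt_two_mul (abs_lt.2 (by omega)),
      dvd_iff_of_abs_lt_two_mul (abs_lt.2 (by omega))]
    omega
  obtain ⟨a, c, i, hac, hca, h⟩ : ∃ a c i : ℤ, a + 1 < c ∧ c + 1 - a ≤ n ∧
      (a = q ∧ c = q + n - 1 ∧ i = c ∧ m = q + n ∨
        a = q + 1 - n ∧ c = q ∧ i = a + 1 ∧ m = q + 1 - n) := by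
    rcases hm with rfl | rfl
    · exact ⟨q, q + n - 1, q + n - 1, by omega⟩
    · exact ⟨q + 1 - n, q, q + 2 - n, by omega⟩
  obtain ⟨z, hz⟩ := exists_nearestSites_helixPt_eq_four hac hca
  refine ⟨z, Set.ext fun s => ?_, i, ?_, ?_⟩
  · simp only [mem_ofPred_eq, hz, mem_insert_iff, mem_singleton_iff]
    refine ⟨fun ⟨hs, hs'⟩ => ?_, fun hs => ⟨by omega, (hdvd s (abs_le.2 (by omega))).2 (by omega)⟩⟩
    rw [hdvd s (abs_le.2 (by omega))] at hs'
    omega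
  · simp only [hz, mem_insert_iff, mem_singleton_iff]
    omega
  · rw [ne_eq, hdvd i (abs_le.2 (by omega))]
    omega

end OutwardDirection

/-! ### Delaunay triangles of the helix -/

section Triples

variable {n : ℕ} {x : E3} {i j k q m : ℤ}

/-- The combinatorial condition for `h_n(i)`, `h_n(j)` and `h_n(k)` to span a Delaunay triangle. -/
def IsDelaunayTriple (n : ℕ) (i j k : ℤ) : Prop :=
  (i ≠ j ∧ i ≠ k ∧ j ≠ k) ∧
  (i - j ≤ n ∧ j - i ≤ n ∧ i - k ≤ n ∧ k - i ≤ n ∧ j - k ≤ n ∧ k - j ≤ n) ∧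
  (i = j + 1 ∨ j = i + 1 ∨ i = k + 1 ∨ k = i + 1 ∨ j = k + 1 ∨ k = j + 1)

/-- Two of the sites `h_n(i)`, `h_n(j)` and `h_n(k)` are exactly one turn of the helix apart. For
Delaunay triangles this characterises those on the boundary of the convex hull of the helix sites,
whose Voronoi edges are rays. -/
def SpansTurn (n : ℕ) (i j k : ℤ) : Prop :=
  i = j + n ∨ j = i + n ∨ i = k + n ∨ k = i + n ∨ j = k + n ∨ k = j + n

theorem IsDelaunayTriple.ncard_eq (h : IsDelaunayTriple n i j k) :
    ({i, j, k} : Set ℤ).ncard = 3 :=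
  ncard_eq_three.2 ⟨i, j, k, h.1.1, h.1.2.1, h.1.2.2, rfl⟩

theorem isDelaunayTriple_of_mem_nearestSites (hn : n ≠ 0) (hij : i ≠ j) (hik : i ≠ k)
    (hjk : j ≠ k) (hi : i ∈ nearestSites (helixPt n) x) (hj : j ∈ nearestSites (helixPt n) x)
    (hk : k ∈ nearestSites (helixPt n) x) : IsDelaunayTriple n i j k := by
  have hle := @sub_le_of_mem_nearestSites n x hn
  refine ⟨⟨hij, hik, hjk⟩, ⟨hle hj hi, hle hi hj, hle hk hi, hle hi hk, hle hk hj, hle hj hk⟩, ?_⟩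
  have hsucc := @eq_add_one_or_eq_add_one_of_mem_nearestSites n x hn
  rcases hij.lt_or_gt with h1 | h1 <;> rcases hik.lt_or_gt with h2 | h2 <;>
    rcases hjk.lt_or_gt with h3 | h3 <;> grind

theorem IsDelaunayTriple.exists_eq_succ (h : IsDelaunayTriple n i j k) : ∃ q m : ℤ,
    ({i, j, k} : Set ℤ) = {q, q + 1, m} ∧ IsDelaunayTriple n q (q + 1) m ∧
      (SpansTurn n q (q + 1) m ↔ SpansTurn n i j k) := by
  unfold IsDelaunayTriple SpansTurn at *
  rcases h.2.2 with rfl | rfl | rfl | rfl | rfl | rfl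
  · exact ⟨j, k, by grind, by omega, by omega⟩
  · exact ⟨i, k, by grind, by omega, by omega⟩
  · exact ⟨k, j, by grind, by omega, by omega⟩
  · exact ⟨i, j, by grind, by omega, by omega⟩
  · exact ⟨k, i, by grind, by omega, by omega⟩
  · exact ⟨j, i, by grind, by omega, by omega⟩

theorem exists_nearestSites_inter_eq_succ (h : IsDelaunayTriple n q (q + 1) m)
    (hturn : ¬ SpansTurn n q (q + 1) m) :
    ∃ x y i j, nearestSites (helixPt n) x ∩ nearestSites (helixPt n) y = {q, q + 1, m} ∧
      (i ∈ nearestSites (helixPt n) x ∧ i ∉ nearestSites (helixPt n) y) ∧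
      j ∈ nearestSites (helixPt n) y ∧ j ∉ nearestSites (helixPt n) x := by
  unfold IsDelaunayTriple at h
  unfold SpansTurn at hturn
  obtain ⟨a, c, b, d, ⟨hac, hca⟩, ⟨hbd, hdb⟩, hI, ⟨i, hi⟩, j, hj⟩ : ∃ a c b d : ℤ,
      (a + 1 < c ∧ c + 1 - a ≤ n) ∧ (b + 1 < d ∧ d + 1 - b ≤ n) ∧
      ({a, a + 1, c, c + 1} ∩ {b, b + 1, d, d + 1} : Set ℤ) = {q, q + 1, m} ∧
      ({a, a + 1, c, c + 1} \ {b, b + 1, d, d + 1} : Set ℤ).Nonempty ∧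
      ({b, b + 1, d, d + 1} \ {a, a + 1, c, c + 1} : Set ℤ).Nonempty := by
    rcases lt_trichotomy m (q - 1) with hm | rfl | hm
    · exact ⟨m - 1, q, m, q, by omega, by omega, by grind, ⟨m - 1, by grind⟩, m + 1, by grind⟩
    · exact ⟨q - 2, q, q - 1, q + 1, by omega, by omega, by grind, ⟨q - 2, by grind⟩, q + 2,
        by grind⟩
    rcases eq_or_ne m (q + 2) with rfl | hm'
    · exact ⟨q - 1, q + 1, q, q + 2, by omega, by omega, by grind, ⟨q - 1, by grind⟩, q + 3,
        by grind⟩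
    · exact ⟨q, m - 1, q, m, by omega, by omega, by grind, ⟨m - 1, by grind⟩, m + 1, by grind⟩
  obtain ⟨x, hx⟩ := exists_nearestSites_helixPt_eq_four hac hca
  obtain ⟨y, hy⟩ := exists_nearestSites_helixPt_eq_four hbd hdb
  rw [← hx, ← hy] at hI hi
  rw [← hx, ← hy] at hj
  exact ⟨x, y, i, j, hI, hi, hj⟩

theorem affineIndependent_helixPt_of_subset (hn : n ≠ 0) {I : Set ℤ}
    (h : I ⊆ nearestSites (helixPt n) x) : AffineIndependent ℝ fun i : I => helixPt n i := by
  obtain ⟨g, hg⟩ : ∃ g : I ↪ nearestSites (helixPt n) x, ∀ i, (g i : ℤ) = i :=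
    ⟨embeddingOfSubset I _ h, fun i => rfl⟩
  simpa only [Function.comp_def, hg] using
    (affineIndependent_nearestSites_helixPt hn x).comp_embedding g

theorem IsDelaunayTriple.isSegment_voronoiFace (hn : n ≠ 0) (h : IsDelaunayTriple n i j k)
    (hturn : ¬ SpansTurn n i j k) : IsSegment (voronoiFace (helixPt n) {i, j, k}) := by
  obtain ⟨q, m, heq, hqm, hiff⟩ := h.exists_eq_succ
  obtain ⟨x, y, i, j, hI, ⟨hi, hi'⟩, hj, hj'⟩ :=
    exists_nearestSites_inter_eq_succ hqm (hiff.not.2 hturn)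
  rw [heq, ← hI]
  refine isSegment_voronoiFace_inter (affineIndependent_helixPt_of_subset hn inter_subset_left) ?_
    hi hi' hj hj'
  rw [hI, hqm.ncard_eq]

theorem IsDelaunayTriple.eq_of_spansTurn (h : IsDelaunayTriple n q (q + 1) m)
    (hturn : SpansTurn n q (q + 1) m) : m = q + n ∨ m = q + 1 - n := by
  unfold IsDelaunayTriple at h
  unfold SpansTurn at hturn
  omega

theorem exists_voronoiFace_eq_rayFrom_outwardDir (hn : 3 ≤ n) (hm : m = q + n ∨ m = q + 1 - n) :
    ∃ z, voronoiFace (helixPt n) {q, q + 1, m} = rayFrom z (outwardDir n q) := by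
  have hn0 : n ≠ 0 := by omega
  obtain ⟨z, hz, i, hi, hi'⟩ := exists_sep_inner_outwardDir_eq hn hm
  refine ⟨z, ?_⟩
  rw [← hz]
  refine voronoiFace_eq_ray (fun s => inner_helixPt_outwardDir_le hn0 s q)
    (finrank_siteOrthogonal_of_ncard_eq_three
      (affineIndependent_helixPt_of_subset hn0 (sep_subset _ _)) ?_) ?_ hi hi'
  · rw [hz]
    exact ncard_eq_three.2 ⟨q, q + 1, m, by omega, by omega, by omega, rfl⟩
  · rw [hz]
    exact insert_nonempty _ _

theorem IsDelaunayTriple.isRay_voronoiFace (hn : 3 ≤ n) (h : IsDelaunayTriple n i j k)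
    (hturn : SpansTurn n i j k) : IsRay (voronoiFace (helixPt n) {i, j, k}) := by
  obtain ⟨q, m, heq, hqm, hiff⟩ := h.exists_eq_succ
  obtain ⟨z, hz⟩ :=
    exists_voronoiFace_eq_rayFrom_outwardDir hn (hqm.eq_of_spansTurn (hiff.2 hturn))
  exact ⟨z, outwardDir n q, outwardDir_ne_zero n q, heq ▸ hz⟩

theorem IsDelaunayTriple.exists_nearestSites_eq (hn : 3 ≤ n) (h : IsDelaunayTriple n i j k) :
    ∃ x, nearestSites (helixPt n) x = {i, j, k} := by
  obtain ⟨q, m, heq, hqm, -⟩ := h.exists_eq_succ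
  rw [heq]
  by_cases hturn : SpansTurn n q (q + 1) m
  · obtain ⟨z, hz, -⟩ := exists_sep_inner_outwardDir_eq hn (hqm.eq_of_spansTurn hturn)
    refine ⟨z + (1 : ℝ) • outwardDir n q, ?_⟩
    rw [nearestSites_add_smul one_pos
      (fun s => inner_helixPt_outwardDir_le (by omega) s q) (hz ▸ insert_nonempty _ _), hz]
  · obtain ⟨x, y, -, -, hI, -⟩ := exists_nearestSites_inter_eq_succ hqm hturn
    exact ⟨midpoint ℝ x y, by rw [nearestSites_midpoint (hI ▸ insert_nonempty _ _), hI]⟩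

end Triples

/-! ### Shapes of the Voronoi facets of the helix -/

section Pairs

variable {n : ℕ} {p q : ℤ}

theorem edges_voronoiFace_pair (hn : 3 ≤ n) (hpq : p ≠ q) :
    edges (voronoiFace (helixPt n) {p, q}) =
      (fun m => voronoiFace (helixPt n) {p, q, m}) '' {m | IsDelaunayTriple n p q m} := by
  have hn0 : n ≠ 0 := by omega
  ext e
  simp only [edges, mem_ofPred_eq]
  rw [isFace_voronoiFace_iff (tendsto_helixPt_cobounded hn0)
    (affineIndependent_nearestSites_helixPt hn0) (insert_nonempty _ _)]
  constructor
  · rintro ⟨x, hx, rfl, hcard⟩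
    obtain ⟨hp, hq⟩ := pair_subset_iff.1 hx
    obtain ⟨m, hm, hmpq⟩ : ∃ m ∈ nearestSites (helixPt n) x, m ∉ ({p, q} : Set ℤ) :=
      exists_mem_notMem_of_ncard_lt_ncard (by rw [ncard_pair hpq]; omega)
    simp only [mem_insert_iff, mem_singleton_iff, not_or] at hmpq
    have h := isDelaunayTriple_of_mem_nearestSites hn0 hpq (Ne.symm hmpq.1) (Ne.symm hmpq.2)
      hp hq hm
    have heq : {p, q, m} = nearestSites (helixPt n) x :=
      eq_of_subset_of_ncard_le (by grind) (by rw [h.ncard_eq]; omega)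
        (nearestSites_finite (tendsto_helixPt_cobounded hn0) x)
    exact ⟨m, h, congrArg _ heq⟩
  · rintro ⟨m, h, rfl⟩
    obtain ⟨x, hx⟩ := h.exists_nearestSites_eq hn
    exact ⟨x, by grind, by rw [hx], by rw [hx, h.ncard_eq]⟩

theorem injOn_voronoiFace_triple (hn : 3 ≤ n) (p q : ℤ) :
    InjOn (fun m => voronoiFace (helixPt n) {p, q, m}) {m | IsDelaunayTriple n p q m} := by
  intro m hm m' hm' h
  obtain ⟨x, hx⟩ := IsDelaunayTriple.exists_nearestSites_eq hn hm
  obtain ⟨y, hy⟩ := IsDelaunayTriple.exists_nearestSites_eq hn hm'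
  simp only [← hx, ← hy] at h
  have hmem : m ∈ ({p, q, m'} : Set ℤ) := by
    rw [← hy, ← nearestSites_eq_of_voronoiFace_eq h, hx]
    simp
  simp only [mem_insert_iff, mem_singleton_iff] at hmem
  have := hm.1
  omega

theorem boundedBy_voronoiFace_pair (hn : 3 ≤ n) (hpq : p ≠ q) {S R : Finset ℤ} {s r : ℕ}
    (hs : S.card = s) (hr : R.card = r)
    (hS : ∀ m, m ∈ S ↔ IsDelaunayTriple n p q m ∧ ¬ SpansTurn n p q m)
    (hR : ∀ m, m ∈ R ↔ IsDelaunayTriple n p q m ∧ SpansTurn n p q m) :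
    BoundedBy (voronoiFace (helixPt n) {p, q}) s r := by
  have hSR : ((S : Set ℤ) ∪ R) = {m | IsDelaunayTriple n p q m} := by
    ext m
    simp only [mem_union, Finset.mem_coe, hS, hR, mem_ofPred_eq, ← and_or_left,
      em', and_true]
  rw [← hs, ← hr]
  exact boundedBy_of_edges_eq_image (by rw [edges_voronoiFace_pair hn hpq, hSR])
    (hSR ▸ injOn_voronoiFace_triple hn p q)
    (fun m hm => ((hS m).1 hm).1.isSegment_voronoiFace (by omega) ((hS m).1 hm).2)
    fun m hm => ((hR m).1 hm).1.isRay_voronoiFace hn ((hR m).1 hm).2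

theorem parallelRays_voronoiFace_pair (hn : 3 ≤ n) (hpq : p ≠ q) {v : E3} (hv : v ≠ 0)
    (h : ∀ m, IsDelaunayTriple n p q m → SpansTurn n p q m →
      ∃ z, voronoiFace (helixPt n) {p, q, m} = rayFrom z v) :
    ParallelRays (voronoiFace (helixPt n) {p, q}) := by
  refine ⟨v, hv, fun e he hray => ?_⟩
  rw [edges_voronoiFace_pair hn hpq] at he
  obtain ⟨m, hm, rfl⟩ := he
  by_cases hturn : SpansTurn n p q m
  · exact h m hm hturn
  · exact (not_isRay_of_isSegment
      (IsDelaunayTriple.isSegment_voronoiFace (by omega) hm hturn) hray).elim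

theorem boundedBy_voronoiFace_add_one (hn : 3 ≤ n) (p : ℤ) :
    BoundedBy (voronoiFace (helixPt n) {p, p + 1}) (2 * n - 4) 2 := by
  refine boundedBy_voronoiFace_pair
    (S := ((Finset.Icc (p + 2 - n) (p + n - 1)).erase p).erase (p + 1)) (R := {p + 1 - n, p + n})
    (by omega) (by omega) ?_ (Finset.card_pair (by omega)) ?_ ?_
  · rw [Finset.card_erase_of_mem (by grind), Finset.card_erase_of_mem (by grind), Int.card_Icc]
    omega
  all_goals
    intro m
    simp only [Finset.mem_insert, Finset.mem_singleton, Finset.mem_erase, Finset.mem_Icc]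
    unfold IsDelaunayTriple SpansTurn
    omega

theorem boundedBy_voronoiFace_add_two (hn : 4 ≤ n) (p : ℤ) :
    BoundedBy (voronoiFace (helixPt n) {p, p + 2}) 3 0 := by
  refine boundedBy_voronoiFace_pair (S := {p - 1, p + 1, p + 3}) (R := ∅) (by omega) (by omega)
    (Finset.card_eq_three.2 ⟨_, _, _, by omega, by omega, by omega, rfl⟩) rfl ?_ ?_
  all_goals
    intro m
    simp only [Finset.mem_insert, Finset.mem_singleton, Finset.notMem_empty, false_iff]
    unfold IsDelaunayTriple SpansTurn
    omega

theorem boundedBy_voronoiFace_add_of_three_le (p : ℤ) {d : ℤ} (hd : 3 ≤ d) (hdn : d ≤ n - 2) :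
    BoundedBy (voronoiFace (helixPt n) {p, p + d}) 4 0 := by
  refine boundedBy_voronoiFace_pair (S := {p - 1, p + 1, p + d - 1, p + d + 1}) (R := ∅)
    (by omega) (by omega) ?_ rfl ?_ ?_
  · rw [Finset.card_insert_of_notMem (by grind), Finset.card_eq_three.2
      ⟨_, _, _, by omega, by omega, by omega, rfl⟩]
  all_goals
    intro m
    simp only [Finset.mem_insert, Finset.mem_singleton, Finset.notMem_empty, false_iff]
    unfold IsDelaunayTriple SpansTurn
    omega

theorem boundedBy_voronoiFace_add_sub_one (hn : 4 ≤ n) (p : ℤ) :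
    BoundedBy (voronoiFace (helixPt n) {p, p + (n - 1)}) 2 2 := by
  refine boundedBy_voronoiFace_pair (S := {p + 1, p + n - 2}) (R := {p - 1, p + n}) (by omega)
    (by omega) (Finset.card_pair (by omega)) (Finset.card_pair (by omega)) ?_ ?_
  all_goals
    intro m
    simp only [Finset.mem_insert, Finset.mem_singleton]
    unfold IsDelaunayTriple SpansTurn
    omega

theorem boundedBy_voronoiFace_add_self (hn : 3 ≤ n) (p : ℤ) :
    BoundedBy (voronoiFace (helixPt n) {p, p + n}) 0 2 := by
  refine boundedBy_voronoiFace_pair (S := ∅) (R := {p + 1, p + n - 1}) (by omega) (by omega) rfl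
    (Finset.card_pair (by omega)) ?_ ?_
  all_goals
    intro m
    simp only [Finset.mem_insert, Finset.mem_singleton, Finset.notMem_empty, false_iff]
    unfold IsDelaunayTriple SpansTurn
    omega

theorem parallelRays_voronoiFace_add_one (hn : 3 ≤ n) (p : ℤ) :
    ParallelRays (voronoiFace (helixPt n) {p, p + 1}) :=
  parallelRays_voronoiFace_pair hn (by omega) (outwardDir_ne_zero n p) fun _ hm hturn =>
    exists_voronoiFace_eq_rayFrom_outwardDir hn (hm.eq_of_spansTurn hturn)

theorem parallelRays_voronoiFace_add_sub_one (hn : 4 ≤ n) (p : ℤ) :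
    ParallelRays (voronoiFace (helixPt n) {p, p + (n - 1)}) := by
  refine parallelRays_voronoiFace_pair (by omega) (by omega) (outwardDir_ne_zero n (p - 1))
    fun m hm hturn => ?_
  unfold IsDelaunayTriple at hm
  unfold SpansTurn at hturn
  obtain rfl | rfl : m = p - 1 ∨ m = p + n := by omega
  · have heq : ({p, p + (n - 1), p - 1} : Set ℤ) = {p - 1, p - 1 + 1, p - 1 + n} := by grind
    rw [heq]
    exact exists_voronoiFace_eq_rayFrom_outwardDir (by omega) (Or.inl rfl)
  · have heq : ({p, p + (n - 1), p + n} : Set ℤ) =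
        {p - 1 + n, p - 1 + n + 1, p - 1 + n + 1 - n} := by grind
    rw [heq, ← outwardDir_add_self (by omega)]
    exact exists_voronoiFace_eq_rayFrom_outwardDir (by omega) (Or.inr rfl)

end Pairs

/-! ### The Voronoi regions of the helix sites -/

section Regions

variable {n : ℕ} {x : E3} {t k : ℤ}

theorem helixRegion_eq_voronoiFace (n : ℕ) (t : ℤ) :
    helixRegion n t = voronoiFace (helixPt n) {t} :=
  voronoiRegion_range (helixPt n) t

theorem helixFacet_eq_voronoiFace (n : ℕ) (t k : ℤ) :
    helixFacet n t k = voronoiFace (helixPt n) {t, t + k} := by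
  rw [helixFacet, helixRegion_eq_voronoiFace, helixRegion_eq_voronoiFace, ← voronoiFace_union,
    singleton_union]

theorem exists_helixFacet_eq_voronoiFace_add (n : ℕ) (t : ℤ) {d : ℤ} (h : |k| = d) :
    ∃ p, helixFacet n t k = voronoiFace (helixPt n) {p, p + d} := by
  rw [helixFacet_eq_voronoiFace]
  obtain rfl | rfl := eq_or_eq_neg_of_abs_eq h
  · exact ⟨t, rfl⟩
  · exact ⟨t + -d, by rw [neg_add_cancel_right, pair_comm]⟩

theorem isPolyhedron_helixRegion (hn : n ≠ 0) (t : ℤ) : IsPolyhedron (helixRegion n t) := by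
  have hregion : helixRegion n t = {x | ∀ s ∈ (Finset.Icc (t - n) (t + n)).erase t,
      sitePower (helixPt n t) x ≤ sitePower (helixPt n s) x} := by
    ext x
    rw [helixRegion_eq_voronoiFace, voronoiFace, mem_ofPred_eq, mem_ofPred_eq,
      singleton_subset_iff]
    refine ⟨fun h s _ => mem_nearestSites_iff.1 h s, fun h =>
      mem_nearestSites_of_forall_abs_sub_le hn fun s hs => ?_⟩
    rw [abs_le] at hs
    rcases eq_or_ne s t with rfl | hst
    · rfl
    · exact h s (by rw [Finset.mem_erase, Finset.mem_Icc]; omega)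
  rw [hregion]
  exact isPolyhedron_setOf_sitePower_le _ _ fun s hs =>
    (helixPt_injective hn).ne (Finset.ne_of_mem_erase hs)

theorem affDim_helixRegion (hn : n ≠ 0) (t : ℤ) : affDim (helixRegion n t) = 3 := by
  have hself := nearestSites_self (helixPt_injective hn) t
  have h := affDim_voronoiFace_add_ncard (tendsto_helixPt_cobounded hn)
    (affineIndependent_nearestSites_helixPt hn _) (hself ▸ singleton_nonempty t)
  rw [hself, ncard_singleton] at h
  rw [helixRegion_eq_voronoiFace]
  omega

theorem isFace_helixRegion_iff (hn : n ≠ 0) {B : Set E3} {d : ℕ} :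
    IsFace (helixRegion n t) B d ↔ ∃ x, t ∈ nearestSites (helixPt n) x ∧
      B = voronoiFace (helixPt n) (nearestSites (helixPt n) x) ∧
      d + (nearestSites (helixPt n) x).ncard = 4 := by
  rw [helixRegion_eq_voronoiFace, isFace_voronoiFace_iff (tendsto_helixPt_cobounded hn)
    (affineIndependent_nearestSites_helixPt hn) (singleton_nonempty t)]
  simp only [singleton_subset_iff]

theorem exists_nearestSites_helixPt_eq_add (t : ℤ) (hk : 1 ≤ |k|) (hkn : |k| ≤ n) :
    ∃ x, nearestSites (helixPt n) x = {t, t + k} := by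
  rw [abs_le] at hkn
  rcases le_abs.1 hk with h | h
  · exact exists_nearestSites_helixPt_eq_pair (by omega) (by omega)
  · rw [pair_comm]
    exact exists_nearestSites_helixPt_eq_pair (by omega) (by omega)

theorem facets_helixRegion (hn : n ≠ 0) (t : ℤ) :
    facets (helixRegion n t) = helixFacet n t '' {k : ℤ | 1 ≤ |k| ∧ |k| ≤ (n : ℤ)} := by
  ext B
  rw [facets, mem_ofPred_eq, isFace_helixRegion_iff hn]
  constructor
  · rintro ⟨x, ht, rfl, hcard⟩
    obtain ⟨m, hmt, hx⟩ : ∃ m, m ≠ t ∧ nearestSites (helixPt n) x = {t, m} := by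
      obtain ⟨m, hmt, hm⟩ :=
        exists_ne_of_one_lt_ncard (s := nearestSites (helixPt n) x) (by omega) t
      refine ⟨m, hm, (eq_of_subset_of_ncard_le (pair_subset ht hmt) ?_
        (nearestSites_finite (tendsto_helixPt_cobounded hn) x)).symm⟩
      rw [ncard_pair hm.symm]
      omega
    have hm : m ∈ nearestSites (helixPt n) x := by rw [hx]; simp
    have hle := sub_le_of_mem_nearestSites hn ht hm
    have hge := sub_le_of_mem_nearestSites hn hm ht
    refine ⟨m - t, ⟨Int.one_le_abs (sub_ne_zero.2 hmt), abs_le.2 (by omega)⟩, ?_⟩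
    rw [helixFacet_eq_voronoiFace, add_sub_cancel, hx]
  · rintro ⟨k, ⟨hk, hkn⟩, rfl⟩
    obtain ⟨x, hx⟩ := exists_nearestSites_helixPt_eq_add t hk hkn
    have hk0 : k ≠ 0 := by rintro rfl; simp at hk
    exact ⟨x, by rw [hx]; simp, by rw [helixFacet_eq_voronoiFace, hx],
      by rw [hx, ncard_pair (by omega)]⟩

theorem injOn_helixFacet (n : ℕ) (t : ℤ) :
    InjOn (helixFacet n t) {k : ℤ | 1 ≤ |k| ∧ |k| ≤ (n : ℤ)} := by
  rintro k ⟨hk, hkn⟩ r ⟨hr, hrn⟩ h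
  obtain ⟨x, hx⟩ := exists_nearestSites_helixPt_eq_add t hk hkn
  obtain ⟨y, hy⟩ := exists_nearestSites_helixPt_eq_add t hr hrn
  rw [helixFacet_eq_voronoiFace, helixFacet_eq_voronoiFace, ← hx, ← hy] at h
  have hmem : t + k ∈ ({t, t + r} : Set ℤ) := by
    rw [← hy, ← nearestSites_eq_of_voronoiFace_eq h, hx]
    simp
  have hk0 : k ≠ 0 := by rintro rfl; simp at hk
  rw [mem_insert_iff, mem_singleton_iff] at hmem
  omega

theorem encard_facets_helixRegion (hn : n ≠ 0) (t : ℤ) :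
    (facets (helixRegion n t)).encard = 2 * n := by
  have hindex : {k : ℤ | 1 ≤ |k| ∧ |k| ≤ (n : ℤ)} =
      ((Finset.Icc (-n : ℤ) n).erase 0 : Finset ℤ) := by
    ext k
    rw [Finset.mem_coe, Finset.mem_erase, Finset.mem_Icc, mem_ofPred_eq, abs_le, le_abs]
    omega
  rw [facets_helixRegion hn, (injOn_helixFacet n t).encard_image, hindex,
    encard_coe_eq_coe_finsetCard, Finset.card_erase_of_mem (by simp), Int.card_Icc,
    show ((n : ℤ) + 1 - -n).toNat - 1 = 2 * n by omega]
  push_cast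
  rfl

theorem exists_halfTurn_helix (τ : ℝ) :
    ∃ σ : E3 ≃ᵃⁱ[ℝ] E3, (∀ x, σ (σ x) = x) ∧ ∀ κ, σ (helix (τ + κ)) = helix (τ - κ) := by
  let p : E3 := !₂[τ, 0, 0]
  let u : E3 := !₂[0, cos τ, sin τ]
  let s : AffineSubspace ℝ E3 := AffineSubspace.mk' p (ℝ ∙ u)
  have : Nonempty s := ⟨p, AffineSubspace.self_mem_mk' _ _⟩
  refine ⟨EuclideanGeometry.reflection s, EuclideanGeometry.reflection_reflection s, fun κ => ?_⟩
  let w : E3 := !₂[κ, -(sin τ * sin κ), cos τ * sin κ]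
  have hadd : helix (τ + κ) = w +ᵥ (cos κ • u +ᵥ p) := by
    rw [helix, cos_add, sin_add]
    ext i
    fin_cases i <;> simp [w, u, p] <;> ring
  have hsub : helix (τ - κ) = -w +ᵥ (cos κ • u +ᵥ p) := by
    rw [helix, cos_sub, sin_sub]
    ext i
    fin_cases i <;> simp [w, u, p] <;> ring
  rw [hadd, hsub]
  refine EuclideanGeometry.reflection_orthogonal_vadd ?_ ?_
  · exact AffineSubspace.vadd_mem_mk' _
      (Submodule.smul_mem _ _ (Submodule.mem_span_singleton_self u))
  · rw [AffineSubspace.direction_mk', Submodule.mem_orthogonal_singleton_iff_inner_right,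
      PiLp.inner_apply, Fin.sum_univ_three]
    simp [w, u]
    ring

theorem exists_symmetry_helixRegion (n : ℕ) (t : ℤ) :
    ∃ σ : E3 ≃ᵃⁱ[ℝ] E3, (∀ x, σ (σ x) = x) ∧ σ '' helixRegion n t = helixRegion n t ∧
      ∀ k : ℤ, σ '' helixFacet n t k = helixFacet n t (-k) := by
  obtain ⟨σ, hσ, hhelix⟩ := exists_halfTurn_helix (helixAngle n t)
  have hsite : ∀ s, σ (helixPt n s) = helixPt n (Equiv.subLeft (2 * t) s) := fun s => by
    have hangle : helixAngle n (2 * t - s) =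
        helixAngle n t - (helixAngle n s - helixAngle n t) := by
      unfold helixAngle
      push_cast
      ring
    rw [Equiv.subLeft_apply, ← helix_helixAngle, ← helix_helixAngle, hangle, ← hhelix,
      add_sub_cancel]
  have himage : ∀ J : Set ℤ, σ '' voronoiFace (helixPt n) J =
      voronoiFace (helixPt n) (Equiv.subLeft (2 * t) '' J) :=
    image_voronoiFace_of_perm σ.toIsometryEquiv (Equiv.subLeft (2 * t)) hsite
  refine ⟨σ, hσ, ?_, fun k => ?_⟩
  · rw [helixRegion_eq_voronoiFace, himage, image_singleton, Equiv.subLeft_apply, two_mul,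
      add_sub_cancel_right]
  · rw [helixFacet_eq_voronoiFace, helixFacet_eq_voronoiFace, himage, image_pair,
      Equiv.subLeft_apply, Equiv.subLeft_apply, show 2 * t - t = t by ring,
      show 2 * t - (t + k) = t + -k by ring]

theorem vectorSpan_voronoiFace_helixPt_add_self (hn : n ≠ 0) (p : ℤ) :
    vectorSpan ℝ (voronoiFace (helixPt n) {p, p + n}) = (ℝ ∙ (!₂[2 * π, 0, 0] : E3))ᗮ := by
  obtain ⟨x, hx⟩ := exists_nearestSites_helixPt_eq_pair (n := n) (p := p) (q := p + n) (by omega)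
    (by omega)
  have hturn : helixPt n (p + n) -ᵥ helixPt n p = !₂[2 * π, 0, 0] := by
    rw [← helix_helixAngle, ← helix_helixAngle, helixAngle_add_self hn, helix, helix,
      cos_add_two_pi, sin_add_two_pi]
    ext i
    fin_cases i <;> simp
  rw [← hx, vectorSpan_voronoiFace (tendsto_helixPt_cobounded hn), hx, siteOrthogonal, image_pair,
    vectorSpan_pair_rev, hturn]

theorem parallel_affineSpan_voronoiFace_helixPt (hn : n ≠ 0) (p q : ℤ) :
    (affineSpan ℝ (voronoiFace (helixPt n) {p, p + n})).Parallel
      (affineSpan ℝ (voronoiFace (helixPt n) {q, q + n})) := by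
  have hne : ∀ s : ℤ, voronoiFace (helixPt n) {s, s + n} ≠ ∅ := fun s => by
    obtain ⟨x, hx⟩ := exists_nearestSites_helixPt_eq_pair (n := n) (p := s) (q := s + n) (by omega)
      (by omega)
    exact nonempty_iff_ne_empty.1 ⟨x, hx.ge⟩
  rw [AffineSubspace.parallel_iff_direction_eq_and_eq_bot_iff_eq_bot, direction_affineSpan,
    direction_affineSpan, vectorSpan_voronoiFace_helixPt_add_self hn,
    vectorSpan_voronoiFace_helixPt_add_self hn, affineSpan_eq_bot, affineSpan_eq_bot]
  exact ⟨rfl, iff_of_false (hne p) (hne q)⟩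

theorem parallel_affineSpan_helixFacet_neg (hn : n ≠ 0) (t : ℤ) :
    (affineSpan ℝ (helixFacet n t n)).Parallel (affineSpan ℝ (helixFacet n t (-n))) := by
  have habs : |(n : ℤ)| = n := abs_of_nonneg (by omega)
  obtain ⟨p, hp⟩ := exists_helixFacet_eq_voronoiFace_add n t habs
  obtain ⟨q, hq⟩ := exists_helixFacet_eq_voronoiFace_add n t ((abs_neg (n : ℤ)).trans habs)
  rw [hp, hq]
  exact parallel_affineSpan_voronoiFace_helixPt hn p q

theorem mem_helixFacet_one_or_neg_one_of_isFace (hn : n ≠ 0) (hx : IsFace (helixRegion n t) {x} 0) :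
    x ∈ helixFacet n t 1 ∨ x ∈ helixFacet n t (-1) := by
  obtain ⟨y, ht, hxy, hcard⟩ := (isFace_helixRegion_iff hn).1 hx
  obtain rfl : y = x := by
    rw [← mem_singleton_iff, hxy]
    exact mem_voronoiFace_nearestSites _ y
  obtain ⟨f, hf⟩ := exists_orderEmb_of_le_ncard (k := 4) (S := nearestSites (helixPt n) y)
    (by omega)
  obtain ⟨hN, hsucc, hsucc', -⟩ := nearestSites_helixPt_eq_of_four_mem hn
    (f.strictMono (show (0 : Fin 4) < 1 by decide)) (f.strictMono (show (1 : Fin 4) < 2 by decide))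
    (f.strictMono (show (2 : Fin 4) < 3 by decide)) (x := y)
    (by simp only [insert_subset_iff, singleton_subset_iff, hf, and_self])
  simp only [helixFacet_eq_voronoiFace, voronoiFace, mem_ofPred_eq, insert_subset_iff,
    singleton_subset_iff, ht, true_and]
  simp only [hN, mem_insert_iff, mem_singleton_iff] at ht ⊢
  omega

end Regions

section Shapes

variable {n : ℕ} {t k i j : ℤ}

theorem boundedBy_helixFacet_of_abs_eq_one (hn : 3 ≤ n) (t : ℤ) (hk : |k| = 1) :
    BoundedBy (helixFacet n t k) (2 * n - 4) 2 ∧ ParallelRays (helixFacet n t k) := by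
  obtain ⟨p, hp⟩ := exists_helixFacet_eq_voronoiFace_add n t hk
  exact hp ▸ ⟨boundedBy_voronoiFace_add_one hn p, parallelRays_voronoiFace_add_one hn p⟩

theorem boundedBy_helixFacet_of_abs_eq_two (hn : 4 ≤ n) (t : ℤ) (hk : |k| = 2) :
    BoundedBy (helixFacet n t k) 3 0 := by
  obtain ⟨p, hp⟩ := exists_helixFacet_eq_voronoiFace_add n t hk
  exact hp ▸ boundedBy_voronoiFace_add_two hn p

theorem boundedBy_helixFacet_of_three_le_abs (t : ℤ) (hk : 3 ≤ |k|) (hkn : |k| ≤ n - 2) :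
    BoundedBy (helixFacet n t k) 4 0 := by
  obtain ⟨p, hp⟩ := exists_helixFacet_eq_voronoiFace_add n t (k := k) rfl
  exact hp ▸ boundedBy_voronoiFace_add_of_three_le p hk hkn

theorem boundedBy_helixFacet_of_abs_eq_sub_one (hn : 4 ≤ n) (t : ℤ) (hk : |k| = n - 1) :
    BoundedBy (helixFacet n t k) 2 2 ∧ ParallelRays (helixFacet n t k) := by
  obtain ⟨p, hp⟩ := exists_helixFacet_eq_voronoiFace_add n t hk
  exact hp ▸ ⟨boundedBy_voronoiFace_add_sub_one hn p, parallelRays_voronoiFace_add_sub_one hn p⟩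

theorem boundedBy_helixFacet_of_abs_eq_self (hn : 3 ≤ n) (t : ℤ) (hk : |k| = n) :
    BoundedBy (helixFacet n t k) 0 2 := by
  obtain ⟨p, hp⟩ := exists_helixFacet_eq_voronoiFace_add n t hk
  exact hp ▸ boundedBy_voronoiFace_add_self hn p

theorem adjacentFacets_helixFacet_iff (hn : 3 ≤ n) (t : ℤ) (hi : i ≠ 0) (hj : j ≠ 0)
    (hij : i ≠ j) :
    AdjacentFacets (helixFacet n t i) (helixFacet n t j) ↔
      IsDelaunayTriple n t (t + i) (t + j) := by
  have hn0 : n ≠ 0 := by omega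
  have hinter : helixFacet n t i ∩ helixFacet n t j =
      voronoiFace (helixPt n) {t, t + i, t + j} := by
    rw [helixFacet_eq_voronoiFace, helixFacet_eq_voronoiFace, ← voronoiFace_union]
    congr 1
    grind
  rw [AdjacentFacets, hinter]
  constructor
  · intro h
    obtain ⟨x, hx⟩ : (voronoiFace (helixPt n) {t, t + i, t + j}).Nonempty := by
      by_contra! hempty
      rw [affDim, hempty, vectorSpan_empty, finrank_bot] at h
      exact zero_ne_one h
    exact isDelaunayTriple_of_mem_nearestSites hn0 (by omega) (by omega) (by omega)
      (hx (by simp)) (hx (by simp)) (hx (by simp))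
  · intro h
    obtain ⟨x, hx⟩ := h.exists_nearestSites_eq hn
    have hdim := affDim_voronoiFace_add_ncard (tendsto_helixPt_cobounded hn0)
      (affineIndependent_nearestSites_helixPt hn0 x) (hx ▸ insert_nonempty _ _)
    rw [hx, h.ncard_eq] at hdim
    omega

theorem adjacentFacets_helixFacet_one_iff (hn : 3 ≤ n) (t : ℤ) (hj : 1 ≤ |j|) (hjn : |j| ≤ n)
    (hj1 : j ≠ 1) :
    AdjacentFacets (helixFacet n t 1) (helixFacet n t j) ↔ j ≠ -(n : ℤ) := by
  rw [le_abs] at hj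
  rw [abs_le] at hjn
  rw [adjacentFacets_helixFacet_iff hn t one_ne_zero (by omega) hj1.symm]
  unfold IsDelaunayTriple
  omega

theorem adjacentFacets_helixFacet_neg_one_iff (hn : 3 ≤ n) (t : ℤ) (hj : 1 ≤ |j|) (hjn : |j| ≤ n)
    (hj1 : j ≠ -1) :
    AdjacentFacets (helixFacet n t (-1)) (helixFacet n t j) ↔ j ≠ n := by
  rw [le_abs] at hj
  rw [abs_le] at hjn
  rw [adjacentFacets_helixFacet_iff hn t (by omega) (by omega) hj1.symm]
  unfold IsDelaunayTriple
  omega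

theorem adjacentFacets_helixFacet_iff_abs_sub_eq_one (hn : 3 ≤ n) (t : ℤ) (hi : 2 ≤ |i|)
    (hin : |i| ≤ n) (hj : 2 ≤ |j|) (hjn : |j| ≤ n) (hij : i ≠ j) :
    AdjacentFacets (helixFacet n t i) (helixFacet n t j) ↔ |i - j| = 1 := by
  rw [le_abs] at hi hj
  rw [abs_le] at hin hjn
  rw [adjacentFacets_helixFacet_iff hn t (by omega) (by omega) hij, abs_eq one_pos.le]
  unfold IsDelaunayTriple
  omega

end Shapes

theorem lemma2 (n : ℕ) (hn : 1 ≤ n) :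
    -- the Delaunay triangulation of `H_n`
    DelaunayIsTriangulation (helixSet n) ∧
    (∀ a b c d : ℤ, a < b → b < c → c < d →
      (IsDelaunaySimplex (helixSet n) {helixPt n a, helixPt n b, helixPt n c, helixPt n d} ↔
        b - a = 1 ∧ d - c = 1 ∧ d - a ≤ (n : ℤ))) ∧
    -- each Voronoi region is a polyhedron with exactly `2n` facets, in `n` symmetric pairs
    (∀ t : ℤ,
      IsPolyhedron (helixRegion n t) ∧ affDim (helixRegion n t) = 3 ∧
      facets (helixRegion n t) = helixFacet n t '' {k : ℤ | 1 ≤ |k| ∧ |k| ≤ (n : ℤ)} ∧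
      (facets (helixRegion n t)).encard = 2 * n ∧
      (∃ σ : E3 ≃ᵃⁱ[ℝ] E3, (∀ x, σ (σ x) = x) ∧ σ '' helixRegion n t = helixRegion n t ∧
        ∀ k : ℤ, σ '' helixFacet n t k = helixFacet n t (-k))) ∧
    -- the shapes and adjacencies of the facets
    (4 ≤ n → ∀ t : ℤ,
      (∀ k : ℤ, |k| = 1 →
        BoundedBy (helixFacet n t k) (2 * n - 4) 2 ∧ ParallelRays (helixFacet n t k)) ∧
      (∀ k : ℤ, |k| = 2 → BoundedBy (helixFacet n t k) 3 0) ∧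
      (∀ k : ℤ, 3 ≤ |k| → |k| ≤ (n : ℤ) - 2 → BoundedBy (helixFacet n t k) 4 0) ∧
      (∀ k : ℤ, |k| = (n : ℤ) - 1 →
        BoundedBy (helixFacet n t k) 2 2 ∧ ParallelRays (helixFacet n t k)) ∧
      (∀ k : ℤ, |k| = (n : ℤ) → BoundedBy (helixFacet n t k) 0 2) ∧
      (affineSpan ℝ (helixFacet n t (n : ℤ))).Parallel
        (affineSpan ℝ (helixFacet n t (-(n : ℤ)))) ∧
      (∀ x : E3, IsFace (helixRegion n t) {x} 0 →
        x ∈ helixFacet n t 1 ∨ x ∈ helixFacet n t (-1)) ∧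
      (∀ j : ℤ, 1 ≤ |j| → |j| ≤ (n : ℤ) → j ≠ 1 →
        (AdjacentFacets (helixFacet n t 1) (helixFacet n t j) ↔ j ≠ -(n : ℤ))) ∧
      (∀ j : ℤ, 1 ≤ |j| → |j| ≤ (n : ℤ) → j ≠ -1 →
        (AdjacentFacets (helixFacet n t (-1)) (helixFacet n t j) ↔ j ≠ (n : ℤ))) ∧
      (∀ i j : ℤ, 2 ≤ |i| → |i| ≤ (n : ℤ) → 2 ≤ |j| → |j| ≤ (n : ℤ) → i ≠ j →
        (AdjacentFacets (helixFacet n t i) (helixFacet n t j) ↔ |i - j| = 1))) := by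
  have hn0 : n ≠ 0 := Nat.one_le_iff_ne_zero.1 hn
  refine ⟨delaunayIsTriangulation_helixSet hn0,
    fun a b c d hab hbc hcd => isDelaunaySimplex_helixSet_four_iff hn0 hab hbc hcd,
    fun t => ⟨isPolyhedron_helixRegion hn0 t, affDim_helixRegion hn0 t, facets_helixRegion hn0 t,
      encard_facets_helixRegion hn0 t, exists_symmetry_helixRegion n t⟩, fun hn4 t => ?_⟩
  have hn3 : 3 ≤ n := Nat.le_of_succ_le hn4
  exact ⟨fun k => boundedBy_helixFacet_of_abs_eq_one hn3 t,
    fun k => boundedBy_helixFacet_of_abs_eq_two hn4 t,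
    fun k => boundedBy_helixFacet_of_three_le_abs t,
    fun k => boundedBy_helixFacet_of_abs_eq_sub_one hn4 t,
    fun k => boundedBy_helixFacet_of_abs_eq_self hn3 t,
    parallel_affineSpan_helixFacet_neg hn0 t,
    fun x => mem_helixFacet_one_or_neg_one_of_isFace hn0,
    fun j => adjacentFacets_helixFacet_one_iff hn3 t,
    fun j => adjacentFacets_helixFacet_neg_one_iff hn3 t,
    fun i j => adjacentFacets_helixFacet_iff_abs_sub_eq_one hn3 t⟩
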